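/- Let $d\in\mathbb N$, $\alpha\in(0,1]$ with $d>\alpha$, and let $|\cdot|$ be the Euclidean norm. Let $\{w_{x,y}\}$, indexed by the unordered pairs of distinct points $x,y\in\mathbb Z^d$ (so $w_{x,y}=w_{y,x}$), be i.i.d. non-negative random variables on a probability space $(\Omega,\mathcal F,\mathbb P)$ with $\mathbb E[w_{x,y}]=1$ and $w_{x,y}\le C_1$ for some constant $C_1>0$. For $m\in\mathbb N$ put $B_{2^m}=(-2^m,2^m]^d\cap\mathbb Z^d$ and $$V_m(x)=\sum_{z\in\mathbb Z^d:\,0<|z|\le 2^m}\frac{z}{|z|^{d+\alpha}}\,w_{x,x+z},\qquad x\in\mathbb Z^d,$$ and for $f=(f^{(1)},\dots,f^{(d)}):B_{2^m}\to\mathbb R^d$ put $$\mathcal L^\omega_{B_{2^m}}f(x)=\sum_{y\in B_{2^m},\,y\ne x}(f(y)-f(x))\frac{w_{x,y}(\omega)}{|x-y|^{d+\alpha}},\qquad \mathscr E^\omega_{B_{2^m}}(f,f)=\frac12\sum_{i=1}^d\sum_{x,y\in B_{2^m},\,x\ne y}\big(f^{(i)}(x)-f^{(i)}(y)\big)^2\frac{w_{x,y}(\omega)}{|x-y|^{d+\alpha}}.$$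 Then for every $\gamma>0$ there exist a (deterministic) constant $C>0$ and a random variable $m^*(\omega)\ge 1$ such that, almost surely, for every integer $m>m^*(\omega)$ the local Poisson equation $$\mathcal L^\omega_{B_{2^m}}\widetilde\phi_m(x)=-V_m(x)+\frac1{|B_{2^m}|}\sum_{y\in B_{2^m}}V_m(y)\quad(x\in B_{2^m}),\qquad \sum_{x\in B_{2^m}}\widetilde\phi_m(x)=0$$ has a unique solution $\widetilde\phi_m:B_{2^m}\to\mathbb R^d$, and $$\mathscr E^\omega_{B_{2^m}}(\widetilde\phi_m,\widetilde\phi_m)\le C\begin{cases} m^{2+\frac{1+\gamma}{(2(d-1))\wedge d}}\,2^{md}, & \alpha=1,\\[1mm] m^{\frac{(1+\gamma)\alpha}{(2(d-\alpha))\wedge d}}\,2^{m(d+2(1-\alpha))}, & \alpha\in(0,1).\end{cases}$$ -/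

import Mathlib

open MeasureTheory ProbabilityTheory

noncomputable section

namespace StableConductance

/-- The lattice `ℤ^d`. -/
abbrev Lat (d : ℕ) : Type := Fin d → ℤ

/-- A lattice point regarded as a vector of `ℝ^d` (with the Euclidean norm). -/
def toE {d : ℕ} (z : Lat d) : EuclideanSpace ℝ (Fin d) :=
  WithLp.toLp 2 fun i => (z i : ℝ)

/-- The Euclidean length `|z|` of a lattice point. -/
def len {d : ℕ} (z : Lat d) : ℝ := ‖toE z‖

/-- The collection of unordered pairs of distinct points of `ℤ^d`. -/
abbrev Edge (d : ℕ) : Type := {e : Sym2 (Lat d) // ¬ e.IsDiag}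

/-- The standing assumption on the random conductances `w_{x,y} = w s(x,y)`, `x ≠ y`: they are
i.i.d., non-negative, of mean one and bounded by a deterministic constant. The symmetry
`w_{x,y} = w_{y,x}` is built in by indexing with unordered pairs; nothing is assumed about the
diagonal values `w s(x,x)`, and they play no role below. -/
structure IsConductance {d : ℕ} {Ω : Type*} [MeasurableSpace Ω] (P : Measure Ω)
    (w : Sym2 (Lat d) → Ω → ℝ) : Prop where
  measurable : ∀ e : Edge d, Measurable (w e)
  indep : iIndepFun (fun e : Edge d => w e) P
  identDistrib : ∀ e e' : Edge d, IdentDistrib (w e) (w e') P P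
  nonneg : ∀ e : Edge d, ∀ᵐ ω ∂P, 0 ≤ w e ω
  mean_one : ∀ e : Edge d, ∫ ω, w e ω ∂P = 1
  bounded : ∃ C₁ : ℝ, 0 < C₁ ∧ ∀ e : Edge d, ∀ᵐ ω ∂P, w e ω ≤ C₁

/-- The box `B_R = (-R, R]^d ∩ ℤ^d`. -/
def box (d R : ℕ) : Finset (Lat d) :=
  Fintype.piFinset fun _ => Finset.Ioc (-(R : ℤ)) (R : ℤ)

/-- The non-zero lattice points with `|z| ≤ R`; see `mem_puncturedBall`. -/
def puncturedBall (d R : ℕ) : Finset (Lat d) :=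
  open Classical in
  (Fintype.piFinset fun _ => Finset.Icc (-(R : ℤ)) (R : ℤ)).filter
    fun z => z ≠ 0 ∧ len z ≤ R

theorem mem_puncturedBall {d R : ℕ} (z : Lat d) :
    z ∈ puncturedBall d R ↔ z ≠ 0 ∧ len z ≤ R := by
  unfold puncturedBall
  simp only [Finset.mem_filter, Fintype.mem_piFinset, Finset.mem_Icc, and_iff_right_iff_imp]
  rintro ⟨-, h⟩ i
  have h1 : ‖toE z i‖ ≤ (R : ℝ) := (PiLp.norm_apply_le (toE z) i).trans h
  have h2 : |(z i : ℝ)| ≤ (R : ℝ) := h1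
  rw [abs_le] at h2
  exact ⟨by exact_mod_cast h2.1, by exact_mod_cast h2.2⟩

section Deterministic

variable {d : ℕ} (α : ℝ) (c : Sym2 (Lat d) → ℝ)

/-- The jump kernel `c_{x,y} / |x - y|^{d + α}` for a realization `c` of the conductances. -/
def kernel (x y : Lat d) : ℝ := c s(x, y) / len (x - y) ^ ((d : ℝ) + α)

/-- The operator `L_U f(x) = ∑_{y ∈ U, y ≠ x} (f(y) - f(x)) c_{x,y} / |x - y|^{d + α}`. -/
def genOn (U : Finset (Lat d)) (f : U → EuclideanSpace ℝ (Fin d)) (x : U) :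
    EuclideanSpace ℝ (Fin d) :=
  ∑ y ∈ Finset.univ.erase x, kernel α c x y • (f y - f x)

/-- The energy
`E_U(f,f) = 1/2 ∑_i ∑_{x,y ∈ U, x ≠ y} (f_i(x) - f_i(y))² c_{x,y} / |x - y|^{d + α}`. -/
def energyOn (U : Finset (Lat d)) (f : U → EuclideanSpace ℝ (Fin d)) : ℝ :=
  (1 / 2) * ∑ i : Fin d, ∑ x : U, ∑ y ∈ Finset.univ.erase x,
    (f x i - f y i) ^ 2 * kernel α c x y

/-- The average of `f` over `U`. -/
def avg (U : Finset (Lat d)) (f : U → EuclideanSpace ℝ (Fin d)) : EuclideanSpace ℝ (Fin d) :=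
  (U.card : ℝ)⁻¹ • ∑ x : U, f x

/-- The truncated drift `V_m(x) = ∑_{|z| ≤ 2^m} z / |z|^{d + α} c_{x,x+z}` (the term `z = 0` is
zero and left out). -/
def drift (m : ℕ) (x : Lat d) : EuclideanSpace ℝ (Fin d) :=
  ∑ z ∈ puncturedBall d (2 ^ m), (c s(x, x + z) / len z ^ ((d : ℝ) + α)) • toE z

/-- `φ` solves the local Poisson equation on `B_{2^m}` with the truncated drift:
`L_{B_{2^m}} φ = -V_m + ⨍_{B_{2^m}} V_m` on `B_{2^m}` and `∑_{B_{2^m}} φ = 0`. -/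
def IsCorrector (m : ℕ) (φ : box d (2 ^ m) → EuclideanSpace ℝ (Fin d)) : Prop :=
  (∀ x : box d (2 ^ m), genOn α c (box d (2 ^ m)) φ x =
      -drift α c m x + avg (box d (2 ^ m)) (fun y => drift α c m y)) ∧
    ∑ x, φ x = 0

end Deterministic

/-- The order of the energy bound. -/
def energyRate (d : ℕ) (α γ : ℝ) (m : ℕ) : ℝ :=
  if α = 1 then
    (m : ℝ) ^ (2 + (1 + γ) / min (2 * ((d : ℝ) - 1)) (d : ℝ)) * (2 : ℝ) ^ ((m : ℝ) * d)
  else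
    (m : ℝ) ^ ((1 + γ) * α / min (2 * ((d : ℝ) - α)) (d : ℝ)) *
      (2 : ℝ) ^ ((m : ℝ) * (d + 2 * (1 - α)))

end StableConductance

end

/-!
Testing the equation with its solution `φ` turns the energy into `∑ x, V_m x * φ x`, and expanding
`φ` over the dyadic cube averages writes this as a sum over scales `2 ^ k` of cube averages of the
drift against increments of `φ`. Two estimates control it.

* Poincaré inequalities: if any two points of every cube of side `2 ^ k` share at least a quarter
  of the cube as weighted common neighbours, then `φ` minus its cube averages is bounded in `L²` by
  `2 ^ (k α)` times the energy. By Hoeffding's inequality and a union bound this holds at all scales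
  `k ≥ k₀` with `2 ^ (k₀ d)` of order `m`; a finer scale inherits the inequality of the scale `k₀`.
  The total loss is the factor `2 ^ (k₀ α)`, which is of order `m ^ (α / d)`.
* Decay of cube averages: the drift is centred because `z ↦ -z` reverses the sign of `z`, and each
  edge contributes at most twice to a cube average, so its variance is of the order of the inverse
  volume `2 ^ (-k d)`.

As `α < d`, the weights `2 ^ (k (d + α) / 2)` in the Cauchy–Schwarz inequality over the scales make
both sums geometric. Markov's inequality and the Borel–Cantelli lemma, which cost a factor `m ^ δ`
for any `δ > 1`, make the second estimate almost sure.
-/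

noncomputable section

namespace StableConductance

open Finset
open scoped BigOperators

theorem factorsThrough_of_le {X ι : Type*} {q : ℕ → X → ι}
    (hq : ∀ k, (q (k + 1)).FactorsThrough (q k)) {j k : ℕ} (hjk : j ≤ k) :
    (q k).FactorsThrough (q j) := by
  induction k, hjk using Nat.le_induction with
  | base => exact fun _ _ h => h
  | succ k _ ih => exact fun _ _ h => hq k (ih h)

section Cell

variable {X ι : Type*} [Fintype X] [DecidableEq ι]

/-- The cell of `x` in the partition of `X` into the fibres of `q`. -/
def cell (q : X → ι) (x : X) : Finset X := {y | q y = q x}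

/-- The conditional expectation of `f` given `q` under the uniform measure on `X`: the average of
`f` over the cell of `x`. -/
def cellAvg (q : X → ι) (f : X → ℝ) (x : X) : ℝ := 𝔼 y ∈ cell q x, f y

variable {q : X → ι}

theorem mem_cell {x y : X} : y ∈ cell q x ↔ q y = q x := by simp [cell]

theorem cell_nonempty (x : X) : (cell q x).Nonempty := ⟨x, mem_cell.2 rfl⟩

theorem cell_congr {x y : X} (h : q y = q x) : cell q y = cell q x := by simp only [cell, h]

theorem sum_cell_comm (F : X → X → ℝ) :
    ∑ x, ∑ y ∈ cell q x, F x y = ∑ x, ∑ y ∈ cell q x, F y x :=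
  sum_comm' fun x y => by simp [mem_cell, eq_comm]

theorem sum_expect_cell_comm (F : X → X → ℝ) :
    ∑ x, 𝔼 y ∈ cell q x, F x y = ∑ x, 𝔼 y ∈ cell q x, F y x := by
  simp only [expect_eq_sum_div_card, sum_div]
  rw [sum_cell_comm]
  exact sum_congr rfl fun x _ => sum_congr rfl fun y hy => by rw [cell_congr (mem_cell.1 hy)]

theorem sum_cellAvg_mul (f g : X → ℝ) :
    ∑ x, cellAvg q f x * g x = ∑ x, f x * cellAvg q g x := by
  simp only [cellAvg, expect_mul, mul_expect]
  exact sum_expect_cell_comm fun x y => f y * g x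

theorem factorsThrough_cellAvg (f : X → ℝ) : (cellAvg q f).FactorsThrough q :=
  fun x y h => by rw [cellAvg, cell_congr h, cellAvg]

theorem cellAvg_of_factorsThrough {f : X → ℝ} (hf : f.FactorsThrough q) : cellAvg q f = f := by
  ext x
  rw [cellAvg, expect_congr rfl fun y hy => hf (mem_cell.1 hy), expect_const (cell_nonempty x)]

theorem sum_sub_cellAvg_mul {u : X → ℝ} (hu : u.FactorsThrough q) (f : X → ℝ) :
    ∑ x, (f x - cellAvg q f x) * u x = 0 := by
  simp only [sub_mul, sum_sub_distrib, sum_cellAvg_mul, cellAvg_of_factorsThrough hu, sub_self]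

theorem sum_sub_cellAvg_sq_le_of_factorsThrough {h : X → ℝ} (hh : h.FactorsThrough q)
    (f : X → ℝ) : ∑ x, (f x - cellAvg q f x) ^ 2 ≤ ∑ x, (f x - h x) ^ 2 := by
  have horth : ∑ x, (f x - cellAvg q f x) * (cellAvg q f x - h x) = 0 :=
    sum_sub_cellAvg_mul (fun x y hxy => by rw [factorsThrough_cellAvg f hxy, hh hxy]) f
  have hpyth : ∑ x, (f x - h x) ^ 2 = ∑ x, (f x - cellAvg q f x) ^ 2 +
      2 * ∑ x, (f x - cellAvg q f x) * (cellAvg q f x - h x) +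
        ∑ x, (cellAvg q f x - h x) ^ 2 := by
    rw [mul_sum, ← sum_add_distrib, ← sum_add_distrib]
    exact sum_congr rfl fun x _ => by ring
  rw [hpyth, horth, mul_zero, add_zero]
  exact le_add_of_nonneg_right (sum_nonneg fun x _ => sq_nonneg _)

theorem sum_sub_cellAvg_sq_le (f : X → ℝ) :
    ∑ x, (f x - cellAvg q f x) ^ 2 ≤ ∑ x, 𝔼 y ∈ cell q x, (f x - f y) ^ 2 := by
  refine sum_le_sum fun x _ => ?_
  have hsub : f x - cellAvg q f x = 𝔼 y ∈ cell q x, (f x - f y) := by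
    rw [expect_sub_distrib, expect_const (cell_nonempty x), cellAvg]
  have hjensen := expect_mul_sq_le_sq_mul_sq (cell q x) (fun y => f x - f y) fun _ => 1
  simpa only [hsub, mul_one, one_pow, expect_const (cell_nonempty x)] using hjensen

theorem sum_mul_eq_sum_cellAvg_mul {q : ℕ → X → ι}
    (hq : ∀ k, (q (k + 1)).FactorsThrough (q k)) (hinj : (q 0).Injective) {n : ℕ} {f : X → ℝ}
    (hf : cellAvg (q n) f = 0) (g : X → ℝ) :
    ∑ x, g x * f x =
      ∑ k ∈ range n, ∑ x, cellAvg (q k) g x * (f x - cellAvg (q (k + 1)) f x) := by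
  have hscale : ∀ k, ∑ x, cellAvg (q k) g x * (f x - cellAvg (q (k + 1)) f x) =
      ∑ x, g x * cellAvg (q k) f x - ∑ x, g x * cellAvg (q (k + 1)) f x := by
    intro k
    have hcoarse : cellAvg (q k) (cellAvg (q (k + 1)) f) = cellAvg (q (k + 1)) f :=
      cellAvg_of_factorsThrough fun x y h => factorsThrough_cellAvg f (hq k h)
    simp only [mul_sub, sum_sub_distrib, sum_cellAvg_mul, hcoarse]
  have hfine : cellAvg (q 0) f = f :=
    cellAvg_of_factorsThrough fun x y h => congrArg f (hinj h)
  rw [sum_congr rfl fun k _ => hscale k, sum_range_sub', hfine, hf]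
  simp

end Cell

theorem le_sum_mul_sum_of_eq_sum_sum_mul {X κ : Type*} [Fintype X] (s : Finset κ)
    {u v : κ → X → ℝ} {p t : κ → ℝ} (hp : ∀ j ∈ s, 0 ≤ p j) (ht : ∀ j ∈ s, 0 < t j) {E : ℝ}
    (hE0 : 0 ≤ E) (hE : E = ∑ j ∈ s, ∑ x, u j x * v j x)
    (hv : ∀ j ∈ s, ∑ x, v j x ^ 2 ≤ p j * E) :
    E ≤ (∑ j ∈ s, p j / t j) * ∑ j ∈ s, t j * ∑ x, u j x ^ 2 := by
  rcases hE0.eq_or_lt with h0 | hpos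
  · rw [← h0]
    exact mul_nonneg (sum_nonneg fun j hj => div_nonneg (hp j hj) (ht j hj).le)
      (sum_nonneg fun j hj => mul_nonneg (ht j hj).le (sum_nonneg fun x _ => sq_nonneg _))
  set I : κ → ℝ := fun j => ∑ x, u j x * v j x
  set U : κ → ℝ := fun j => ∑ x, u j x ^ 2
  have hU : ∀ j, 0 ≤ U j := fun j => sum_nonneg fun x _ => sq_nonneg _
  have hinner : ∀ j ∈ s, I j ^ 2 ≤ p j / t j * E * (t j * U j) := fun j hj =>
    calc I j ^ 2 ≤ U j * ∑ x, v j x ^ 2 := sum_mul_sq_le_sq_mul_sq univ (u j) (v j)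
      _ ≤ U j * (p j * E) := mul_le_mul_of_nonneg_left (hv j hj) (hU j)
      _ = p j / t j * E * (t j * U j) := by
        have := (ht j hj).ne'
        field_simp
  have houter : (∑ j ∈ s, I j) ^ 2 ≤ (∑ j ∈ s, p j / t j * E) * ∑ j ∈ s, t j * U j :=
    sum_sq_le_sum_mul_sum_of_sq_le_mul s
      (fun j hj => mul_nonneg (div_nonneg (hp j hj) (ht j hj).le) hE0)
      (fun j hj => mul_nonneg (ht j hj).le (hU j)) hinner
  refine le_of_mul_le_mul_left ?_ hpos
  calc E * E = (∑ j ∈ s, I j) ^ 2 := by rw [← hE, sq]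
    _ ≤ (∑ j ∈ s, p j / t j * E) * ∑ j ∈ s, t j * U j := houter
    _ = E * ((∑ j ∈ s, p j / t j) * ∑ j ∈ s, t j * U j) := by rw [← sum_mul]; ring

section Energy

variable {X : Type*} [Fintype X]

/-- The Dirichlet form of a kernel `K` on a finite set. -/
def dirichlet (K : X → X → ℝ) (f : X → ℝ) : ℝ :=
  (1 / 2) * ∑ x, ∑ y, K x y * (f x - f y) ^ 2

/-- The generator of the jump process with rates `K` on a finite set. -/
def generator (K : X → X → ℝ) : (X → ℝ) →ₗ[ℝ] (X → ℝ) :=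
  LinearMap.pi fun x => ∑ y, K x y •
    (LinearMap.proj (R := ℝ) (φ := fun _ => ℝ) y - LinearMap.proj x)

theorem generator_apply (K : X → X → ℝ) (f : X → ℝ) (x : X) :
    generator K f x = ∑ y, K x y * (f y - f x) := by
  simp [generator]

variable {K : X → X → ℝ}

theorem dirichlet_nonneg (hK0 : ∀ x y, 0 ≤ K x y) (f : X → ℝ) : 0 ≤ dirichlet K f :=
  mul_nonneg (by norm_num) <| sum_nonneg fun x _ => sum_nonneg fun y _ =>
    mul_nonneg (hK0 x y) (sq_nonneg _)

theorem sum_generator_mul (hK : ∀ x y, K x y = K y x) (f g : X → ℝ) :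
    ∑ x, generator K f x * g x = -(1 / 2) * ∑ x, ∑ y, K x y * (f x - f y) * (g x - g y) := by
  have hswap : ∑ x, ∑ y, K x y * (f y - f x) * g x = ∑ x, ∑ y, K x y * (f x - f y) * g y := by
    rw [sum_comm]
    simp only [hK]
  have hsum : ∑ x, ∑ y, K x y * (f x - f y) * (g x - g y) =
      -(∑ x, ∑ y, K x y * (f y - f x) * g x + ∑ x, ∑ y, K x y * (f x - f y) * g y) := by
    simp only [← sum_add_distrib, ← sum_neg_distrib]
    exact sum_congr rfl fun x _ => sum_congr rfl fun y _ => by ring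
  simp only [generator_apply, sum_mul]
  linarith

theorem sum_generator_mul_self (hK : ∀ x y, K x y = K y x) (f : X → ℝ) :
    ∑ x, generator K f x * f x = -dirichlet K f := by
  simp only [sum_generator_mul hK, dirichlet, mul_assoc, ← sq, neg_mul]

theorem sum_generator (hK : ∀ x y, K x y = K y x) (f : X → ℝ) : ∑ x, generator K f x = 0 := by
  simpa using sum_generator_mul hK f fun _ => 1

theorem existsUnique_generator_eq [Nonempty X] (hK : ∀ x y, K x y = K y x)
    (hconst : ∀ f : X → ℝ, dirichlet K f = 0 → ∑ x, f x = 0 → f = 0) {g : X → ℝ}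
    (hg : ∑ x, g x = 0) : ∃! f : X → ℝ, generator K f = g ∧ ∑ x, f x = 0 := by
  -- Adding the total sum to the generator makes it invertible without changing it on mean-zero
  -- functions.
  let T : (X → ℝ) →ₗ[ℝ] (X → ℝ) := generator K + LinearMap.pi fun _ => ∑ y, LinearMap.proj y
  have hT : ∀ f x, T f x = generator K f x + ∑ y, f y := fun f x => by simp [T]
  have hsum : ∀ f, ∑ x, T f x = 0 → ∑ x, f x = 0 := fun f hf => by
    simpa [hT, sum_add_distrib, sum_generator hK] using hf
  have hinj : Function.Injective T := by
    refine LinearMap.ker_eq_bot.1 (LinearMap.ker_eq_bot'.2 fun f hf => ?_)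
    have hf0 := hsum f (by simp [hf])
    have hgen : ∀ x, generator K f x = 0 := fun x => by simpa [hf0, hf] using (hT f x).symm
    exact hconst f (by simpa [hgen] using sum_generator_mul_self hK f) hf0
  obtain ⟨f, rfl⟩ := LinearMap.injective_iff_surjective.1 hinj g
  refine ⟨f, ⟨funext fun x => by rw [hT, hsum f hg, add_zero], hsum f hg⟩, ?_⟩
  rintro f' ⟨hf', hf'0⟩
  exact hinj (funext fun x => by rw [hT, hf', hf'0, add_zero])

theorem dirichlet_eq_sum_mul (hK : ∀ x y, K x y = K y x) {f g : X → ℝ} {b : ℝ}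
    (hf : ∀ x, generator K f x = -g x + b) (hf0 : ∑ x, f x = 0) :
    dirichlet K f = ∑ x, g x * f x := by
  have h := sum_generator_mul_self hK f
  simp only [hf, add_mul, neg_mul, sum_add_distrib, sum_neg_distrib, ← mul_sum, hf0, mul_zero,
    add_zero, neg_inj] at h
  exact h.symm

variable {ι : Type*} [DecidableEq ι] {q : ℕ → X → ι} {k₀ n : ℕ} {a κ : ℝ} {f : X → ℝ}

theorem sum_sub_cellAvg_sq_le_of_coarse (hq : ∀ k, (q (k + 1)).FactorsThrough (q k))
    (hk₀ : k₀ ≤ n) (ha : 1 ≤ a) {B : ℝ} (hB : 0 ≤ B)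
    (hpoinc : ∀ k, k₀ ≤ k → k ≤ n → ∑ x, (f x - cellAvg (q k) f x) ^ 2 ≤ a ^ k * B)
    {k : ℕ} (hk : k ≤ n) : ∑ x, (f x - cellAvg (q k) f x) ^ 2 ≤ a ^ k₀ * a ^ k * B := by
  rcases le_total k₀ k with h | h
  · refine (hpoinc k h hk).trans ?_
    gcongr
    exact le_mul_of_one_le_left (by positivity) (one_le_pow₀ ha)
  · have hfine : (cellAvg (q k₀) f).FactorsThrough (q k) :=
      fun _ _ hxy => factorsThrough_cellAvg f (factorsThrough_of_le hq h hxy)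
    refine (sum_sub_cellAvg_sq_le_of_factorsThrough hfine f).trans
      ((hpoinc k₀ le_rfl hk₀).trans ?_)
    gcongr
    exact le_mul_of_one_le_right (by positivity) (one_le_pow₀ ha)

theorem dirichlet_le_of_poincare (hK : ∀ x y, K x y = K y x) (hK0 : ∀ x y, 0 ≤ K x y)
    (hq : ∀ k, (q (k + 1)).FactorsThrough (q k)) (hinj : (q 0).Injective)
    (htop : ∀ x y, q n x = q n y) (hk₀ : k₀ ≤ n) (ha : 1 ≤ a) {ρ : ℝ} (hρ : a < ρ) (hκ : 0 ≤ κ)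
    (hpoinc : ∀ k, k₀ ≤ k → k ≤ n →
      ∑ x, (f x - cellAvg (q k) f x) ^ 2 ≤ a ^ k * (κ * dirichlet K f))
    {g : X → ℝ} {b : ℝ} (hf : ∀ x, generator K f x = -g x + b) (hf0 : ∑ x, f x = 0) :
    dirichlet K f ≤
      κ * a ^ k₀ * (a / (1 - a / ρ)) * ∑ k ∈ range n, ρ ^ k * ∑ x, cellAvg (q k) g x ^ 2 := by
  have ha0 : 0 < a := one_pos.trans_le ha
  have hρ0 : 0 < ρ := ha0.trans hρ
  have hD0 := dirichlet_nonneg hK0 f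
  have hmean : cellAvg (q n) f = 0 := by
    ext x
    have hcell : cell (q n) x = univ := eq_univ_of_forall fun y => mem_cell.2 (htop y x)
    rw [cellAvg, hcell, expect_eq_sum_div_card, hf0, zero_div, Pi.zero_apply]
  have hD : dirichlet K f =
      ∑ k ∈ range n, ∑ x, cellAvg (q k) g x * (f x - cellAvg (q (k + 1)) f x) :=
    (dirichlet_eq_sum_mul hK hf hf0).trans (sum_mul_eq_sum_cellAvg_mul hq hinj hmean g)
  have hscale : ∀ k ∈ range n, ∑ x, (f x - cellAvg (q (k + 1)) f x) ^ 2 ≤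
      κ * a ^ k₀ * a ^ (k + 1) * dirichlet K f := fun k hk => by
    refine (sum_sub_cellAvg_sq_le_of_coarse hq hk₀ ha (mul_nonneg hκ hD0) hpoinc
      (k := k + 1) (mem_range.1 hk)).trans_eq ?_
    ring
  have hgeom : ∑ k ∈ range n, κ * a ^ k₀ * a ^ (k + 1) / ρ ^ k ≤
      κ * a ^ k₀ * (a / (1 - a / ρ)) := by
    have hterm : ∀ k, κ * a ^ k₀ * a ^ (k + 1) / ρ ^ k = κ * a ^ k₀ * a * (a / ρ) ^ k :=
      fun k => by rw [div_pow, pow_succ]; ring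
    have hsum := geom_sum_Ico_le_of_lt_one (m := 0) (n := n) (div_pos ha0 hρ0).le
      ((div_lt_one hρ0).2 hρ)
    rw [sum_congr rfl fun k _ => hterm k, ← mul_sum, range_eq_Ico]
    calc _ ≤ κ * a ^ k₀ * a * ((a / ρ) ^ 0 / (1 - a / ρ)) := by gcongr
      _ = _ := by ring
  refine (le_sum_mul_sum_of_eq_sum_sum_mul (range n) (fun k _ => by positivity)
    (fun k _ => pow_pos hρ0 k) hD0 hD hscale).trans ?_
  gcongr

end Energy

section CommonNeighbours

/-- The number of common neighbours of `x` and `y` in `Q`, each path `x, z, y` being weighted by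
the product of the conductances `c` along it. -/
def commonWeight {V : Type*} [DecidableEq V] (c : Sym2 V → ℝ) (Q : Finset V) (x y : V) : ℝ :=
  ∑ z ∈ Q \ {x, y}, c s(x, z) * c s(z, y)

/-- Any two points of a cell of `q` are joined through at least a quarter of the points of that
cell. -/
def HasCommonNeighbours {X ι : Type*} [Fintype X] [DecidableEq X] [DecidableEq ι]
    (c : Sym2 X → ℝ) (q : X → ι) : Prop :=
  ∀ x y, x ≠ y → q x = q y → ((cell q x).card : ℝ) / 4 ≤ commonWeight c (cell q x) x y

theorem mul_sub_sq_nonneg {V : Type*} {c : Sym2 V → ℝ} (hc : ∀ e, ¬ e.IsDiag → 0 ≤ c e)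
    (f : V → ℝ) (x y : V) : 0 ≤ c s(x, y) * (f x - f y) ^ 2 := by
  rcases eq_or_ne x y with rfl | h
  · simp
  · exact mul_nonneg (hc _ (by simpa using h)) (sq_nonneg _)

theorem commonWeight_mul_sub_sq_le {V : Type*} [DecidableEq V] {c : Sym2 V → ℝ} {C : ℝ}
    (hC : 0 ≤ C) (hc : ∀ e, ¬ e.IsDiag → c e ∈ Set.Icc 0 C) (Q : Finset V) (f : V → ℝ) (x y : V) :
    commonWeight c Q x y * (f x - f y) ^ 2 ≤
      2 * C * (∑ z ∈ Q, c s(x, z) * (f x - f z) ^ 2 + ∑ z ∈ Q, c s(y, z) * (f y - f z) ^ 2) := by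
  have hc0 : ∀ e, ¬ e.IsDiag → 0 ≤ c e := fun e he => (hc e he).1
  rw [commonWeight, sum_mul, ← sum_add_distrib, mul_sum]
  refine (sum_le_sum fun z hz => ?_).trans (sum_le_sum_of_subset_of_nonneg sdiff_subset
    fun z _ _ => ?_)
  · simp only [mem_sdiff, mem_insert, mem_singleton, not_or] at hz
    obtain ⟨hx0, hxC⟩ := hc s(x, z) (by simpa using Ne.symm hz.2.1)
    obtain ⟨hy0, hyC⟩ := hc s(y, z) (by simpa using Ne.symm hz.2.2)
    rw [Sym2.eq_swap (a := z)]
    have hsq : (f x - f y) ^ 2 ≤ 2 * ((f x - f z) ^ 2 + (f y - f z) ^ 2) := by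
      nlinarith [sq_nonneg (f x - f z + (f y - f z))]
    calc c s(x, z) * c s(y, z) * (f x - f y) ^ 2
        ≤ c s(x, z) * c s(y, z) * (2 * ((f x - f z) ^ 2 + (f y - f z) ^ 2)) := by gcongr
      _ = 2 * (c s(y, z) * (c s(x, z) * (f x - f z) ^ 2) +
            c s(x, z) * (c s(y, z) * (f y - f z) ^ 2)) := by ring
      _ ≤ 2 * (C * (c s(x, z) * (f x - f z) ^ 2) + C * (c s(y, z) * (f y - f z) ^ 2)) := by gcongr
      _ = _ := by ring
  · exact mul_nonneg (by positivity) (add_nonneg (mul_sub_sq_nonneg hc0 f x z)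
      (mul_sub_sq_nonneg hc0 f y z))

variable {X ι : Type*} [Fintype X] [DecidableEq X] [DecidableEq ι] {c : Sym2 X → ℝ} {C : ℝ}
  {q : X → ι}

theorem HasCommonNeighbours.sub_sq_le (hq : HasCommonNeighbours c q) (hC : 0 ≤ C)
    (hc : ∀ e, ¬ e.IsDiag → c e ∈ Set.Icc 0 C) (f : X → ℝ) {x y : X} (hxy : q y = q x) :
    (f x - f y) ^ 2 ≤ 8 * C * (𝔼 z ∈ cell q x, c s(x, z) * (f x - f z) ^ 2 +
      𝔼 z ∈ cell q y, c s(y, z) * (f y - f z) ^ 2) := by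
  have hcard : (0 : ℝ) < (cell q x).card := by exact_mod_cast card_pos.2 (cell_nonempty x)
  have hc0 : ∀ e, ¬ e.IsDiag → 0 ≤ c e := fun e he => (hc e he).1
  have hnonneg : ∀ x, 0 ≤ ∑ z ∈ cell q x, c s(x, z) * (f x - f z) ^ 2 :=
    fun x => sum_nonneg fun z _ => mul_sub_sq_nonneg hc0 f x z
  simp only [expect_eq_sum_div_card, cell_congr hxy, ← add_div]
  rw [← mul_div_assoc, le_div_iff₀ hcard]
  rcases eq_or_ne x y with rfl | hne
  · rw [sub_self, zero_pow two_ne_zero, zero_mul]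
    have := hnonneg x
    positivity
  have hmany := mul_le_mul_of_nonneg_right (hq x y hne hxy.symm) (sq_nonneg (f x - f y))
  linarith [commonWeight_mul_sub_sq_le hC hc (cell q x) f x y]

theorem HasCommonNeighbours.sum_expect_sub_sq_le (hq : HasCommonNeighbours c q) (hC : 0 ≤ C)
    (hc : ∀ e, ¬ e.IsDiag → c e ∈ Set.Icc 0 C) (f : X → ℝ) :
    ∑ x, 𝔼 y ∈ cell q x, (f x - f y) ^ 2 ≤
      16 * C * ∑ x, 𝔼 y ∈ cell q x, c s(x, y) * (f x - f y) ^ 2 := by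
  set G : X → ℝ := fun x => 𝔼 z ∈ cell q x, c s(x, z) * (f x - f z) ^ 2
  calc ∑ x, 𝔼 y ∈ cell q x, (f x - f y) ^ 2
      ≤ ∑ x, 𝔼 y ∈ cell q x, 8 * C * (G x + G y) :=
        sum_le_sum fun x _ => expect_le_expect fun _ hy => hq.sub_sq_le hC hc f (mem_cell.1 hy)
    _ = 8 * C * (∑ x, 𝔼 _y ∈ cell q x, G x + ∑ x, 𝔼 y ∈ cell q x, G y) := by
        simp only [← mul_expect, ← mul_sum, expect_add_distrib, sum_add_distrib]
    _ = 16 * C * ∑ x, G x := by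
        rw [sum_expect_cell_comm fun _ y => G y]
        simp only [expect_const (cell_nonempty _)]
        ring

theorem HasCommonNeighbours.poincare (hq : HasCommonNeighbours c q) (hC : 0 ≤ C)
    (hc : ∀ e, ¬ e.IsDiag → c e ∈ Set.Icc 0 C) {K : X → X → ℝ} (hK : ∀ x y, 0 ≤ K x y) {R : ℝ}
    (hR : 0 ≤ R) (hcK : ∀ x y, x ≠ y → q x = q y → c s(x, y) ≤ R * (cell q x).card * K x y)
    (f : X → ℝ) :
    ∑ x, (f x - cellAvg q f x) ^ 2 ≤ 32 * C * R * dirichlet K f := by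
  have hcell : ∀ x, 𝔼 y ∈ cell q x, c s(x, y) * (f x - f y) ^ 2 ≤
      R * ∑ y, K x y * (f x - f y) ^ 2 := fun x => by
    have hcard : (0 : ℝ) < (cell q x).card := by exact_mod_cast card_pos.2 (cell_nonempty x)
    rw [expect_eq_sum_div_card, div_le_iff₀ hcard, mul_sum, sum_mul]
    refine (sum_le_sum fun y hy => ?_).trans (sum_le_sum_of_subset_of_nonneg (subset_univ _)
      fun y _ _ => mul_nonneg (mul_nonneg hR (mul_nonneg (hK x y) (sq_nonneg _))) hcard.le)
    rcases eq_or_ne x y with rfl | hne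
    · simp
    calc c s(x, y) * (f x - f y) ^ 2 ≤ R * (cell q x).card * K x y * (f x - f y) ^ 2 := by
          gcongr
          exact hcK x y hne (mem_cell.1 hy).symm
      _ = _ := by ring
  calc ∑ x, (f x - cellAvg q f x) ^ 2
      ≤ 16 * C * ∑ x, 𝔼 y ∈ cell q x, c s(x, y) * (f x - f y) ^ 2 :=
        (sum_sub_cellAvg_sq_le f).trans (hq.sum_expect_sub_sq_le hC hc f)
    _ ≤ 16 * C * ∑ x, R * ∑ y, K x y * (f x - f y) ^ 2 := by
        gcongr with x
        exact hcell x
    _ = 32 * C * R * dirichlet K f := by rw [← mul_sum, dirichlet]; ring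

end CommonNeighbours

section Lattice

variable {d : ℕ}

theorem toE_apply (z : Lat d) (i : Fin d) : toE z i = z i := rfl

theorem abs_apply_le_len (z : Lat d) (i : Fin d) : |(z i : ℝ)| ≤ len z :=
  PiLp.norm_apply_le (toE z) i

theorem len_neg (z : Lat d) : len (-z) = len z := by
  have : toE (-z) = -toE z := by ext i; simp [toE_apply]
  rw [len, this, norm_neg, len]

theorem len_nonneg (z : Lat d) : 0 ≤ len z := norm_nonneg _

theorem one_le_len {z : Lat d} (hz : z ≠ 0) : 1 ≤ len z := by
  obtain ⟨i, hi⟩ := Function.ne_iff.1 hz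
  refine le_trans ?_ (abs_apply_le_len z i)
  exact_mod_cast Int.one_le_abs hi

theorem len_le_of_abs_le {z : Lat d} {r : ℝ} (hr : 0 ≤ r) (h : ∀ i, |(z i : ℝ)| ≤ r) :
    len z ≤ √d * r := by
  rw [len, EuclideanSpace.norm_eq, ← Real.sqrt_sq hr, ← Real.sqrt_mul (by positivity)]
  refine Real.sqrt_le_sqrt ?_
  calc ∑ i, ‖toE z i‖ ^ 2 ≤ ∑ _i : Fin d, r ^ 2 := by
        gcongr with i
        exact h i
    _ = d * r ^ 2 := by simp

theorem mem_box {m : ℕ} {x : Lat d} : x ∈ box d (2 ^ m) ↔ ∀ i, x i ∈ Ioc (-2 ^ m : ℤ) (2 ^ m) := by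
  simp [box]

theorem card_box (m : ℕ) : (box d (2 ^ m)).card = 2 ^ ((m + 1) * d) := by
  have hside : ((2 ^ m : ℤ) + 2 ^ m).toNat = 2 ^ (m + 1) := by
    rw [← two_mul, ← pow_succ']
    exact Int.toNat_natCast (2 ^ (m + 1))
  simp [box, Fintype.card_piFinset, hside, pow_mul]

/-- The index of the dyadic cube of side `2 ^ k` containing the point `x` of `B_{2^m}`; the cubes
are positioned so that those with `k ≤ m + 1` tile the box. -/
def boxIndex (m k : ℕ) (x : box d (2 ^ m)) : Lat d := fun i => (x.1 i + 2 ^ m - 1) / 2 ^ k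

variable {m k : ℕ}

theorem boxIndex_zero_injective : (boxIndex (d := d) m 0).Injective := by
  intro x y h
  ext i
  simpa [boxIndex] using congrFun h i

theorem boxIndex_succ_factorsThrough (k : ℕ) :
    (boxIndex (d := d) m (k + 1)).FactorsThrough (boxIndex m k) := by
  intro x y h
  ext i
  have hi : (x.1 i + 2 ^ m - 1) / 2 ^ k = (y.1 i + 2 ^ m - 1) / 2 ^ k := congrFun h i
  simp only [boxIndex, pow_succ, ← Int.ediv_ediv_of_nonneg (pow_nonneg zero_le_two k), hi]

theorem boxIndex_top (x : box d (2 ^ m)) : boxIndex m (m + 1) x = 0 := by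
  ext i
  have hx := mem_Ioc.1 (mem_box.1 x.2 i)
  refine Int.ediv_eq_zero_of_lt (by lia) ?_
  rw [pow_succ]
  lia

theorem ediv_two_pow_eq_iff {s j : ℤ} :
    (s + 2 ^ m - 1) / 2 ^ k = j ↔
      s ∈ Ico (j * 2 ^ k - 2 ^ m + 1) (j * 2 ^ k - 2 ^ m + 1 + 2 ^ k) := by
  rw [Int.ediv_eq_iff_of_pos (by positivity), mem_Ico]
  constructor <;> rintro ⟨h1, h2⟩ <;> constructor <;> linarith

theorem Ico_subset_Ioc_two_pow (hk : k ≤ m + 1) {s j : ℤ} (hs : s ∈ Ioc (-2 ^ m : ℤ) (2 ^ m))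
    (hj : (s + 2 ^ m - 1) / 2 ^ k = j) :
    Ico (j * 2 ^ k - 2 ^ m + 1) (j * 2 ^ k - 2 ^ m + 1 + 2 ^ k) ⊆ Ioc (-2 ^ m : ℤ) (2 ^ m) := by
  obtain ⟨hs1, hs2⟩ := mem_Ioc.1 hs
  obtain ⟨l, hl⟩ := Nat.exists_eq_add_of_le hk
  have hside : (2 : ℤ) ^ l * 2 ^ k = 2 * 2 ^ m := by rw [← pow_add, add_comm l, ← hl, pow_succ']
  have h2k : (0 : ℤ) < 2 ^ k := by positivity
  have hj0 : 0 ≤ j * 2 ^ k := mul_nonneg (hj ▸ Int.ediv_nonneg (by lia) h2k.le) h2k.le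
  have hjl : (j + 1) * 2 ^ k ≤ 2 ^ l * 2 ^ k := by
    refine mul_le_mul_of_nonneg_right (Int.add_one_le_iff.2 ?_) h2k.le
    exact hj ▸ Int.ediv_lt_of_lt_mul h2k (by lia)
  intro t ht
  obtain ⟨ht1, ht2⟩ := mem_Ico.1 ht
  exact mem_Ioc.2 ⟨by linarith, by linarith⟩

theorem card_cell_boxIndex (hk : k ≤ m + 1) (x : box d (2 ^ m)) :
    (cell (boxIndex m k) x).card = 2 ^ (k * d) := by
  set a : Fin d → ℤ := fun i => boxIndex m k x i * 2 ^ k - 2 ^ m + 1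
  have hcube : (cell (boxIndex m k) x).map (Function.Embedding.subtype (· ∈ box d (2 ^ m))) =
      Fintype.piFinset fun i => Ico (a i) (a i + 2 ^ k) := by
    ext y
    simp only [mem_map, mem_cell, Function.Embedding.subtype_apply, Subtype.exists,
      exists_and_right, exists_eq_right, Fintype.mem_piFinset]
    constructor
    · rintro ⟨hy, h⟩ i
      exact ediv_two_pow_eq_iff.1 (congrFun h i)
    · intro h
      exact ⟨mem_box.2 fun i => Ico_subset_Ioc_two_pow hk (mem_box.1 x.2 i) rfl (h i),
        funext fun i => ediv_two_pow_eq_iff.2 (h i)⟩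
  have hside : ((2 : ℤ) ^ k).toNat = 2 ^ k := Int.toNat_natCast (2 ^ k)
  rw [← card_map, hcube, Fintype.card_piFinset]
  simp [hside, pow_mul]

theorem len_sub_le_of_boxIndex_eq {x y : box d (2 ^ m)} (h : boxIndex m k x = boxIndex m k y) :
    len (x.1 - y.1) ≤ √d * 2 ^ k := by
  refine len_le_of_abs_le (by positivity) fun i => ?_
  have hx := mem_Ico.1 (ediv_two_pow_eq_iff.1 (congrFun h i))
  have hy := mem_Ico.1 (ediv_two_pow_eq_iff.1 (rfl : boxIndex m k y i = boxIndex m k y i))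
  have hxy : |x.1 i - y.1 i| ≤ 2 ^ k := abs_le.2 ⟨by linarith, by linarith⟩
  rw [Pi.sub_apply]
  exact_mod_cast hxy

end Lattice

section Corrector

variable {d : ℕ} {α : ℝ} {c : Sym2 (Lat d) → ℝ} {m k : ℕ} {C : ℝ}

theorem kernel_comm (x y : Lat d) : kernel α c x y = kernel α c y x := by
  rw [kernel, kernel, Sym2.eq_swap, ← len_neg (x - y), neg_sub]

theorem kernel_nonneg (hα : 0 < α) (hc : ∀ e, ¬ e.IsDiag → 0 ≤ c e) (x y : Lat d) :
    0 ≤ kernel α c x y := by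
  rcases eq_or_ne x y with rfl | h
  · have hlen : len (x - x) = 0 := norm_eq_zero.2 (by ext; simp [toE_apply])
    rw [kernel, hlen, Real.zero_rpow (by positivity), div_zero]
  · exact div_nonneg (hc _ (by simpa using h)) (Real.rpow_nonneg (len_nonneg _) _)

theorem le_mul_kernel (hα : 0 < α) {r : ℝ} {x y : Lat d} (hxy : x ≠ y)
    (hc : 0 ≤ c s(x, y)) (hr : len (x - y) ≤ r) :
    c s(x, y) ≤ r ^ ((d : ℝ) + α) * kernel α c x y := by
  have hlen : 0 < len (x - y) := one_pos.trans_le (one_le_len (sub_ne_zero.2 hxy))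
  have hpow := Real.rpow_le_rpow hlen.le hr (by positivity : (0 : ℝ) ≤ d + α)
  rw [kernel, mul_div_assoc', le_div_iff₀ (by positivity), mul_comm]
  gcongr

theorem poincare_boxIndex (hα : 0 < α) (hC : 0 ≤ C) (hc : ∀ e, ¬ e.IsDiag → c e ∈ Set.Icc 0 C)
    (hk : k ≤ m + 1) (hn : HasCommonNeighbours (c ∘ Sym2.map Subtype.val) (boxIndex m k))
    (f : box d (2 ^ m) → ℝ) :
    ∑ x, (f x - cellAvg (boxIndex m k) f x) ^ 2 ≤ ((2 : ℝ) ^ α) ^ k *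
      (32 * C * √d ^ ((d : ℝ) + α) *
        dirichlet (fun x y : box d (2 ^ m) => kernel α c x y) f) := by
  have hinj : ∀ e : Sym2 (box d (2 ^ m)), ¬ e.IsDiag → ¬ (e.map Subtype.val).IsDiag :=
    fun e he => by rwa [Sym2.isDiag_map Subtype.val_injective]
  have hpow : (√d * 2 ^ k) ^ ((d : ℝ) + α) =
      √d ^ ((d : ℝ) + α) * ((2 : ℝ) ^ α) ^ k * (2 : ℝ) ^ (k * d) := by
    have htwo : (0 : ℝ) < 2 ^ k := by positivity
    rw [Real.mul_rpow (Real.sqrt_nonneg _) htwo.le, Real.rpow_add htwo, Real.rpow_natCast,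
      ← pow_mul, Real.rpow_pow_comm zero_le_two]
    ring
  refine (hn.poincare hC (fun e he => hc _ (hinj e he)) (fun x y => kernel_nonneg hα
    (fun e he => (hc e he).1) x y) (R := √d ^ ((d : ℝ) + α) * ((2 : ℝ) ^ α) ^ k) (by positivity)
    (fun x y hne hxy => ?_) f).trans_eq (by ring)
  rw [card_cell_boxIndex hk]
  push_cast
  rw [← hpow]
  have hne' : x.1 ≠ y.1 := Subtype.coe_ne_coe.2 hne
  exact le_mul_kernel hα hne' (hc _ (by simpa using hne')).1 (len_sub_le_of_boxIndex_eq hxy)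

theorem genOn_apply (U : Finset (Lat d)) (f : U → EuclideanSpace ℝ (Fin d)) (x : U) (i : Fin d) :
    genOn α c U f x i = generator (fun x y : U => kernel α c x y) (fun y => f y i) x := by
  rw [genOn, generator_apply, WithLp.ofLp_sum, Finset.sum_apply, ← sum_erase univ (a := x)]
  · rfl
  · simp

theorem energyOn_eq_sum_dirichlet (U : Finset (Lat d)) (f : U → EuclideanSpace ℝ (Fin d)) :
    energyOn α c U f =
      ∑ i, dirichlet (fun x y : U => kernel α c x y) (fun x => f x i) := by
  simp only [energyOn, dirichlet, mul_sum]
  refine sum_congr rfl fun i _ => sum_congr rfl fun x _ => ?_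
  rw [← sum_erase univ (a := x)]
  · exact sum_congr rfl fun y _ => by ring
  · simp

theorem isCorrector_iff {φ : box d (2 ^ m) → EuclideanSpace ℝ (Fin d)} :
    IsCorrector α c m φ ↔ ∀ i,
      generator (fun x y : box d (2 ^ m) => kernel α c x y) (fun x => φ x i) =
        (fun x : box d (2 ^ m) =>
          -drift α c m x i + avg (box d (2 ^ m)) (fun y => drift α c m y) i) ∧
      ∑ x, φ x i = 0 := by
  simp only [IsCorrector, PiLp.ext_iff, WithLp.ofLp_sum, Finset.sum_apply, genOn_apply,
    funext_iff, forall_and]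
  rw [forall_comm]
  rfl

theorem sum_neg_drift_add_avg (i : Fin d) :
    ∑ x : box d (2 ^ m), (-drift α c m x i +
      avg (box d (2 ^ m)) (fun y => drift α c m y) i) = 0 := by
  have hN : ((box d (2 ^ m)).card : ℝ) ≠ 0 := by
    rw [card_box]
    positivity
  rw [sum_add_distrib, sum_const, sum_neg_distrib, nsmul_eq_mul, card_univ, Fintype.card_coe, avg,
    PiLp.smul_apply, smul_eq_mul, mul_inv_cancel_left₀ hN, WithLp.ofLp_sum, Finset.sum_apply]
  exact neg_add_cancel _

theorem existsUnique_isCorrector (hα : 0 < α) (hC : 0 ≤ C)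
    (hc : ∀ e, ¬ e.IsDiag → c e ∈ Set.Icc 0 C)
    (hn : HasCommonNeighbours (c ∘ Sym2.map Subtype.val) (boxIndex m (m + 1))) :
    ∃! φ : box d (2 ^ m) → EuclideanSpace ℝ (Fin d), IsCorrector α c m φ := by
  have : Nonempty (box d (2 ^ m)) := by
    rw [← Fintype.card_pos_iff, Fintype.card_coe, card_box]
    positivity
  have hconst : ∀ f : box d (2 ^ m) → ℝ,
      dirichlet (fun x y : box d (2 ^ m) => kernel α c x y) f = 0 → ∑ x, f x = 0 → f = 0 := by
    intro f hf hf0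
    have hpoinc := poincare_boxIndex hα hC hc le_rfl hn f
    have htop : ∀ x : box d (2 ^ m), cell (boxIndex m (m + 1)) x = univ :=
      fun x => eq_univ_of_forall fun y => mem_cell.2 (by simp only [boxIndex_top])
    simp only [hf, mul_zero, cellAvg, htop, expect_eq_sum_div_card, hf0, zero_div, sub_zero]
      at hpoinc
    have hsq := (sum_eq_zero_iff_of_nonneg fun x _ => sq_nonneg (f x)).1
      (hpoinc.antisymm (sum_nonneg fun x _ => sq_nonneg (f x)))
    exact funext fun x => pow_eq_zero_iff two_ne_zero |>.1 (hsq x (mem_univ x))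
  choose f hf huniq using fun i => existsUnique_generator_eq
    (fun x y => kernel_comm (α := α) (c := c) x.1 y.1) hconst (sum_neg_drift_add_avg i)
  simp only [isCorrector_iff]
  refine ⟨fun x => WithLp.toLp 2 fun i => f i x, hf, fun φ hφ => ?_⟩
  ext x i
  exact congrFun (huniq i (fun x => φ x i) (hφ i)) x

/-- The fluctuations of the drift at the dyadic scales: the square of the cube averages at scale
`2 ^ k` is summed with weight `2 ^ (k (d + α) / 2)`, the geometric mean of the growth `2 ^ (k α)`
of the Poincaré constants and of the growth `2 ^ (k d)` of the volumes. -/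
def driftFluctuation (α : ℝ) (c : Sym2 (Lat d) → ℝ) (m : ℕ) : ℝ :=
  ∑ i, ∑ k ∈ range (m + 1), ((2 : ℝ) ^ (((d : ℝ) + α) / 2)) ^ k *
    ∑ x : box d (2 ^ m), cellAvg (boxIndex m k) (fun y => drift α c m y i) x ^ 2

theorem driftFluctuation_nonneg : 0 ≤ driftFluctuation α c m := by
  unfold driftFluctuation
  positivity

theorem exists_energyOn_le_driftFluctuation (hα : 0 < α) (hd : α < d) (hC : 0 < C) :
    ∃ D : ℝ, 0 < D ∧ ∀ (c : Sym2 (Lat d) → ℝ) (m k₀ : ℕ), (∀ e, ¬ e.IsDiag → c e ∈ Set.Icc 0 C) →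
      k₀ ≤ m + 1 → (∀ k, k₀ ≤ k → k ≤ m + 1 →
        HasCommonNeighbours (c ∘ Sym2.map Subtype.val) (boxIndex m k)) →
      ∀ φ, IsCorrector α c m φ →
        energyOn α c (box d (2 ^ m)) φ ≤ D * (((2 : ℝ) ^ α) ^ k₀ * driftFluctuation α c m) := by
  have hd0 : (0 : ℝ) < d := hα.trans hd
  have ha : (1 : ℝ) ≤ 2 ^ α := Real.one_le_rpow one_le_two hα.le
  have hρ : (2 : ℝ) ^ α < 2 ^ (((d : ℝ) + α) / 2) :=
    Real.rpow_lt_rpow_of_exponent_lt one_lt_two (by linarith)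
  have hgap : (0 : ℝ) < 1 - 2 ^ α / 2 ^ (((d : ℝ) + α) / 2) :=
    sub_pos.2 ((div_lt_one (by positivity)).2 hρ)
  refine ⟨32 * C * √d ^ ((d : ℝ) + α) * (2 ^ α / (1 - 2 ^ α / 2 ^ (((d : ℝ) + α) / 2))),
    by positivity, fun c m k₀ hc hk₀ hn φ hφ => ?_⟩
  rw [energyOn_eq_sum_dirichlet, driftFluctuation, ← mul_assoc, mul_sum]
  refine sum_le_sum fun i _ => ?_
  obtain ⟨hgen, hsum⟩ := isCorrector_iff.1 hφ i
  refine (dirichlet_le_of_poincare (X := box d (2 ^ m)) (fun x y => kernel_comm _ _)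
    (fun x y => kernel_nonneg hα (fun e he => (hc e he).1) x y) boxIndex_succ_factorsThrough
    boxIndex_zero_injective (fun x y => by simp only [boxIndex_top]) hk₀ ha hρ (by positivity)
    (fun k hk₀k hkm => poincare_boxIndex hα hC.le hc hkm (hn k hk₀k hkm) _)
    (congrFun hgen) hsum).trans_eq ?_
  ring

end Corrector

section Drift

variable {d : ℕ} {α : ℝ}

/-- The coefficient `z_i / |z|^{d + α}` of `c_{x,x+z}` in the `i`-th component of the drift. -/
def driftCoeff (α : ℝ) (i : Fin d) (z : Lat d) : ℝ := z i / len z ^ ((d : ℝ) + α)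

theorem drift_apply (c : Sym2 (Lat d) → ℝ) (m : ℕ) (x : Lat d) (i : Fin d) :
    drift α c m x i = ∑ z ∈ puncturedBall d (2 ^ m), driftCoeff α i z * c s(x, x + z) := by
  rw [drift, WithLp.ofLp_sum, Finset.sum_apply]
  refine sum_congr rfl fun z _ => ?_
  rw [PiLp.smul_apply, toE_apply, driftCoeff, smul_eq_mul]
  ring

theorem sum_driftCoeff (m : ℕ) (i : Fin d) :
    ∑ z ∈ puncturedBall d (2 ^ m), driftCoeff α i z = 0 := by
  have hodd : ∑ z ∈ puncturedBall d (2 ^ m), driftCoeff α i z =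
      ∑ z ∈ puncturedBall d (2 ^ m), -driftCoeff α i z := by
    refine sum_nbij' (fun z => -z) (fun z => -z) ?_ ?_ (by simp) (by simp) ?_ <;> intro z hz
    · simpa [mem_puncturedBall, len_neg] using hz
    · simpa [mem_puncturedBall, len_neg] using hz
    · simp [driftCoeff, len_neg, neg_div]
  rw [sum_neg_distrib] at hodd
  linarith

end Drift

/-- A random field of independent conductances on the edges of the complete graph on `V`, of mean
one and with values in `[0, C]`. Edges are non-diagonal unordered pairs, and `w` is unconstrained on
the diagonal. -/
structure IsIndepConductance {V Ω : Type*} [MeasurableSpace Ω] (P : Measure Ω)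
    (w : Sym2 V → Ω → ℝ) (C : ℝ) : Prop where
  measurable : ∀ e, ¬ e.IsDiag → Measurable (w e)
  indep : iIndepFun (fun e : {e : Sym2 V // ¬ e.IsDiag} => w e) P
  mem_Icc : ∀ e, ¬ e.IsDiag → ∀ᵐ ω ∂P, w e ω ∈ Set.Icc 0 C
  integral_eq_one : ∀ e, ¬ e.IsDiag → ∫ ω, w e ω ∂P = 1

theorem IsIndepConductance.comap {U V Ω : Type*} [MeasurableSpace Ω] {P : Measure Ω}
    {w : Sym2 V → Ω → ℝ} {C : ℝ} (hw : IsIndepConductance P w C) {j : U → V} (hj : j.Injective) :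
    IsIndepConductance P (fun e => w (e.map j)) C := by
  have hdiag : ∀ e : Sym2 U, ¬ e.IsDiag → ¬ (e.map j).IsDiag := fun e he => by
    rwa [Sym2.isDiag_map hj]
  exact
    { measurable := fun e he => hw.measurable _ (hdiag e he)
      indep := hw.indep.precomp (g := fun e : {e : Sym2 U // ¬ e.IsDiag} =>
        (⟨e.1.map j, hdiag _ e.2⟩ : {e : Sym2 V // ¬ e.IsDiag})) fun e e' h =>
          Subtype.ext (Sym2.map.injective hj (congrArg Subtype.val h))
      mem_Icc := fun e he => hw.mem_Icc _ (hdiag e he)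
      integral_eq_one := fun e he => hw.integral_eq_one _ (hdiag e he) }

theorem IsIndepConductance.ae_mem_Icc {V Ω : Type*} [Countable V] [MeasurableSpace Ω]
    {P : Measure Ω} {w : Sym2 V → Ω → ℝ} {C : ℝ} (hw : IsIndepConductance P w C) :
    ∀ᵐ ω ∂P, ∀ e, ¬ e.IsDiag → w e ω ∈ Set.Icc 0 C := by
  have : Countable (Sym2 V) := inferInstanceAs (Countable (Quot _))
  exact ae_all_iff.2 fun e => Filter.eventually_imp_distrib_left.2 fun he => hw.mem_Icc e he

section Concentration

variable {Ω : Type*} [MeasurableSpace Ω] {P : Measure Ω} [IsProbabilityMeasure P]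

theorem hasSubgaussianMGF_one_sub_mul {X Y : Ω → ℝ} (hX : Measurable X) (hY : Measurable Y)
    (hXY : IndepFun X Y P) {C : ℝ} (hXC : ∀ᵐ ω ∂P, X ω ∈ Set.Icc 0 C)
    (hYC : ∀ᵐ ω ∂P, Y ω ∈ Set.Icc 0 C) (hX1 : ∫ ω, X ω ∂P = 1) (hY1 : ∫ ω, Y ω ∂P = 1) :
    HasSubgaussianMGF (fun ω => 1 - X ω * Y ω) ((‖C ^ 2‖₊ / 2) ^ 2) P := by
  have hmem : ∀ᵐ ω ∂P, X ω * Y ω ∈ Set.Icc 0 (C ^ 2) := by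
    filter_upwards [hXC, hYC] with ω hx hy
    exact ⟨mul_nonneg hx.1 hy.1,
      (mul_le_mul hx.2 hy.2 hy.1 (hx.1.trans hx.2)).trans_eq (sq C).symm⟩
  have hint : Integrable (fun ω => X ω * Y ω) P := .of_mem_Icc 0 (C ^ 2) (by fun_prop) hmem
  have hmean : ∫ ω, 1 - X ω * Y ω ∂P = 0 := by
    rw [integral_sub (integrable_const _) hint, hXY.integral_fun_mul_eq_mul_integral
      hX.aestronglyMeasurable hY.aestronglyMeasurable, hX1, hY1]
    simp
  have hsub := hasSubgaussianMGF_of_mem_Icc_of_integral_eq_zero (a := 1 - C ^ 2) (b := 1)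
    (by fun_prop) (hmem.mono fun ω h => ⟨by linarith [h.2], by linarith [h.1]⟩) hmean
  rwa [sub_sub_cancel] at hsub

theorem hasSubgaussianMGF_sum_one_sub_mul {ι : Type*} {X : ι ⊕ ι → Ω → ℝ}
    (hX : ∀ i, Measurable (X i)) (hindep : iIndepFun X P) {C : ℝ}
    (hXC : ∀ i, ∀ᵐ ω ∂P, X i ω ∈ Set.Icc 0 C) (hX1 : ∀ i, ∫ ω, X i ω ∂P = 1) (T : Finset ι) :
    HasSubgaussianMGF (fun ω => ∑ i ∈ T, (1 - X (.inl i) ω * X (.inr i) ω))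
      (T.card * (‖C ^ 2‖₊ / 2) ^ 2) P := by
  classical
  induction T using Finset.induction_on with
  | empty => simp
  | insert a T ha ih =>
    have hone := hasSubgaussianMGF_one_sub_mul (hX (.inl a)) (hX (.inr a))
      (hindep.indepFun Sum.inl_ne_inr) (hXC _) (hXC _) (hX1 _) (hX1 _)
    have hdisj : Disjoint (({a} : Finset ι).disjSum {a}) (T.disjSum T) := by
      simp [disjoint_left, ha]
    have hpair := (hindep.indepFun_finset _ _ hdisj hX).comp
      (φ := fun g : ({a} : Finset ι).disjSum {a} → ℝ => 1 - g ⟨.inl a, by simp⟩ *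
        g ⟨.inr a, by simp⟩)
      (ψ := fun g : T.disjSum T → ℝ => ∑ i ∈ T.attach, (1 - g ⟨.inl i, by simp⟩ *
        g ⟨.inr i, by simp⟩))
      (by fun_prop) (by fun_prop)
    simp only [sum_insert ha, card_insert_of_notMem ha, Nat.cast_add_one, add_one_mul,
      add_comm _ ((‖C ^ 2‖₊ / 2) ^ 2)]
    refine hone.add_of_indepFun ih (hpair.congr ?_ ?_)
    · exact .rfl
    · exact .of_forall fun ω => sum_attach T fun i => 1 - X (.inl i) ω * X (.inr i) ω

namespace IsIndepConductance

variable {V : Type*} {w : Sym2 V → Ω → ℝ} {C : ℝ}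

theorem integrable (hw : IsIndepConductance P w C) {e : Sym2 V} (he : ¬ e.IsDiag) :
    Integrable (w e) P :=
  .of_mem_Icc 0 C (hw.measurable e he).aemeasurable (hw.mem_Icc e he)

theorem one_le (hw : IsIndepConductance P w C) {e : Sym2 V} (he : ¬ e.IsDiag) : 1 ≤ C := by
  have hle := integral_mono_ae (hw.integrable he) (integrable_const C)
    ((hw.mem_Icc e he).mono fun ω h => h.2)
  simpa [hw.integral_eq_one e he] using hle

theorem hasSubgaussianMGF_card_sub_commonWeight [DecidableEq V] (hw : IsIndepConductance P w C)
    (Q : Finset V) {x y : V} (hxy : x ≠ y) :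
    HasSubgaussianMGF
      (fun ω => ((Q \ {x, y}).card : ℝ) - commonWeight (fun e => w e ω) Q x y)
      ((Q \ {x, y}).card * (‖C ^ 2‖₊ / 2) ^ 2) P := by
  set S := Q \ {x, y} with hS
  have hne : ∀ z : S, x ≠ z.1 ∧ z.1 ≠ y := fun z => by
    have hz := z.2
    simp only [hS, mem_sdiff, mem_insert, mem_singleton, not_or] at hz
    exact ⟨Ne.symm hz.2.1, hz.2.2⟩
  let e : S ⊕ S → {e : Sym2 V // ¬ e.IsDiag} :=
    Sum.elim (fun z => ⟨s(x, z), by simpa using (hne z).1⟩)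
      (fun z => ⟨s(z, y), by simpa using (hne z).2⟩)
  have he : e.Injective := by
    refine Function.Injective.sumElim (fun z z' h => ?_) (fun z z' h => ?_) fun z z' h => ?_
    · exact Subtype.ext (Sym2.congr_right.1 (congrArg Subtype.val h))
    · exact Subtype.ext (Sym2.congr_left.1 (congrArg Subtype.val h))
    · rcases Sym2.eq_iff.1 (congrArg Subtype.val h) with ⟨h, -⟩ | ⟨h, -⟩
      exacts [(hne z').1 h, hxy h]
  have hsub := hasSubgaussianMGF_sum_one_sub_mul (fun i => hw.measurable _ (e i).2)
    (hw.indep.precomp he) (fun i => hw.mem_Icc _ (e i).2) (fun i => hw.integral_eq_one _ (e i).2)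
    univ
  rw [card_univ, Fintype.card_coe] at hsub
  refine hsub.congr (.of_forall fun ω => ?_)
  simp only [sum_sub_distrib, sum_const, card_univ, Fintype.card_coe, nsmul_one, commonWeight,
    ← hS, ← sum_coe_sort S]
  rfl

theorem measureReal_commonWeight_lt_le [DecidableEq V] (hw : IsIndepConductance P w C)
    {Q : Finset V} {x y : V} (hx : x ∈ Q) (hy : y ∈ Q) (hxy : x ≠ y) (hQ : 4 ≤ Q.card) :
    P.real {ω | commonWeight (fun e => w e ω) Q x y < (Q.card : ℝ) / 4} ≤
      Real.exp (-(Q.card / (4 * C ^ 4))) := by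
  have hC : 0 < C := one_pos.trans_le (hw.one_le (e := s(x, y)) (by simpa using hxy))
  have hcard : ((Q \ {x, y}).card : ℝ) = Q.card - 2 := by
    have hsub : {x, y} ⊆ Q := by simp [insert_subset_iff, hx, hy]
    rw [card_sdiff_of_subset hsub, card_pair hxy, Nat.cast_sub (by lia), Nat.cast_two]
  have hQ' : (4 : ℝ) ≤ Q.card := by exact_mod_cast hQ
  have htail := (hw.hasSubgaussianMGF_card_sub_commonWeight Q hxy).measure_ge_le
    (ε := (Q.card - 2) / 2) (by linarith)
  refine (measureReal_mono fun ω hω => ?_).trans (htail.trans (Real.exp_le_exp.2 ?_))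
  · rw [Set.mem_ofPred_eq, hcard]
    linarith [show commonWeight (fun e => w e ω) Q x y < (Q.card : ℝ) / 4 from hω]
  · have hvar : (((Q \ {x, y}).card * (‖C ^ 2‖₊ / 2) ^ 2 : NNReal) : ℝ) =
        (Q.card - 2) * (C ^ 4 / 4) := by
      push_cast
      rw [hcard, Real.norm_of_nonneg (by positivity)]
      ring
    have hpos : (0 : ℝ) < Q.card - 2 := by linarith
    have hexp : -((Q.card - 2 : ℝ) / 2) ^ 2 / (2 * ((Q.card - 2) * (C ^ 4 / 4))) =
        -((Q.card - 2) / (2 * C ^ 4)) := by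
      field_simp
      ring
    rw [hvar, hexp, neg_le_neg_iff, div_le_div_iff₀ (by positivity) (by positivity)]
    nlinarith [pow_pos hC 4]

end IsIndepConductance

end Concentration

section Scales

open Filter

theorem eventually_mul_le_two_pow (a : ℕ) : ∀ᶠ m : ℕ in atTop, a * m ≤ 2 ^ m := by
  have hlim := (tendsto_pow_const_div_const_pow_of_one_lt 1 (one_lt_two (α := ℝ))).const_mul (a : ℝ)
  rw [mul_zero] at hlim
  filter_upwards [hlim.eventually_le_const one_pos] with m hm
  rw [pow_one, ← mul_div_assoc, div_le_one (by positivity)] at hm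
  exact_mod_cast hm

theorem exists_scale {d : ℕ} (hd : 0 < d) {α : ℝ} (hα : 0 ≤ α) (a : ℝ) :
    ∃ B : ℝ, 0 < B ∧ ∀ᶠ m : ℕ in atTop, ∃ k ≤ m + 1, 4 ≤ 2 ^ (k * d) ∧ a * m ≤ 2 ^ (k * d) ∧
      ((2 : ℝ) ^ α) ^ k ≤ B * (m : ℝ) ^ (α / d) := by
  obtain ⟨l, hl⟩ := exists_nat_ge (max a 4)
  have hl4 : 4 ≤ l := by exact_mod_cast (le_max_right _ _).trans hl
  refine ⟨(2 ^ d * l : ℝ) ^ (α / d), by positivity, ?_⟩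
  filter_upwards [eventually_mul_le_two_pow l, eventually_ge_atTop 1] with m hm hm1
  have hb : 1 < 2 ^ d := Nat.one_lt_two_pow hd.ne'
  have hlm : 4 ≤ l * m := hl4.trans (Nat.le_mul_of_pos_right l hm1)
  set k := Nat.clog (2 ^ d) (l * m)
  have hpow : (2 ^ d) ^ k = 2 ^ (k * d) := by rw [← pow_mul, mul_comm]
  have hle : l * m ≤ 2 ^ (k * d) := hpow ▸ Nat.le_pow_clog hb _
  have hge : 2 ^ (k * d) ≤ 2 ^ d * (l * m) := by
    have hk0 : 0 < k := Nat.clog_pos hb (by lia)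
    have hpred := Nat.pow_pred_clog_lt_self hb (x := l * m) (by lia)
    rw [← hpow, ← Nat.sub_add_cancel hk0, pow_succ']
    exact Nat.mul_le_mul_left _ hpred.le
  refine ⟨k, Nat.clog_le_of_le_pow (hm.trans ?_), hlm.trans hle, ?_, ?_⟩
  · rw [← pow_mul]
    exact Nat.pow_le_pow_right two_pos (by nlinarith)
  · calc a * m ≤ l * m := by gcongr; exact (le_max_left _ _).trans hl
      _ ≤ 2 ^ (k * d) := by exact_mod_cast hle
  · calc ((2 : ℝ) ^ α) ^ k = ((2 : ℝ) ^ (k * d)) ^ (α / d) := by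
          rw [← Real.rpow_natCast, ← Real.rpow_natCast, ← Real.rpow_mul zero_le_two,
            ← Real.rpow_mul zero_le_two]
          congr 1
          push_cast
          field_simp
      _ ≤ (2 ^ d * l * m : ℝ) ^ (α / d) := by
          gcongr
          rw [mul_assoc]
          exact_mod_cast hge
      _ = (2 ^ d * l : ℝ) ^ (α / d) * (m : ℝ) ^ (α / d) :=
          Real.mul_rpow (by positivity) (by positivity)

end Scales

section UnionBound

variable {Ω : Type*} [MeasurableSpace Ω] {P : Measure Ω} [IsProbabilityMeasure P] {C : ℝ}

theorem measureReal_not_hasCommonNeighbours_le {X ι : Type*} [Fintype X] [DecidableEq X]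
    [DecidableEq ι] {w : Sym2 X → Ω → ℝ} (hw : IsIndepConductance P w C) (q : X → ι) {N : ℕ}
    (hN : 4 ≤ N) (hq : ∀ x, N ≤ (cell q x).card) :
    P.real {ω | ¬ HasCommonNeighbours (fun e => w e ω) q} ≤
      (Fintype.card X : ℝ) ^ 2 * Real.exp (-(N / (4 * C ^ 4))) := by
  set S : Finset (X × X) := {p | p.1 ≠ p.2 ∧ q p.1 = q p.2} with hS
  have hcover : {ω | ¬ HasCommonNeighbours (fun e => w e ω) q} ⊆ ⋃ p ∈ S,
      {ω | commonWeight (fun e => w e ω) (cell q p.1) p.1 p.2 < ((cell q p.1).card : ℝ) / 4} := by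
    intro ω hω
    simp only [HasCommonNeighbours, Set.mem_ofPred_eq, not_forall, not_le] at hω
    obtain ⟨x, y, hne, hxy, hlt⟩ := hω
    exact Set.mem_biUnion (x := (x, y)) (by simp [hS, hne, hxy]) hlt
  calc P.real {ω | ¬ HasCommonNeighbours (fun e => w e ω) q}
      ≤ ∑ p ∈ S, P.real {ω | commonWeight (fun e => w e ω) (cell q p.1) p.1 p.2 <
          ((cell q p.1).card : ℝ) / 4} :=
        (measureReal_mono hcover (measure_ne_top _ _)).trans
          (measureReal_biUnion_finset_le _ _)
    _ ≤ ∑ _p ∈ S, Real.exp (-(N / (4 * C ^ 4))) := by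
        refine sum_le_sum fun p hp => ?_
        obtain ⟨hne, heq⟩ := (mem_filter.1 hp).2
        refine (hw.measureReal_commonWeight_lt_le (mem_cell.2 rfl) (mem_cell.2 heq.symm) hne
          (hN.trans (hq _))).trans ?_
        gcongr
        exact hq _
    _ ≤ (Fintype.card X : ℝ) ^ 2 * Real.exp (-(N / (4 * C ^ 4))) := by
        rw [sum_const, nsmul_eq_mul]
        gcongr
        rw [sq]
        exact_mod_cast (card_le_univ S).trans_eq (Fintype.card_prod X X)

variable {d : ℕ} {w : Sym2 (Lat d) → Ω → ℝ} {m k₀ : ℕ}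

theorem measureReal_not_hasCommonNeighbours_boxIndex_le (hw : IsIndepConductance P w C)
    (hC : 0 < C) (hk₀ : 4 ≤ 2 ^ (k₀ * d)) (hm : 4 * C ^ 4 * (2 * d + 1) * m ≤ 2 ^ (k₀ * d))
    {k : ℕ} (hk₀k : k₀ ≤ k) (hkm : k ≤ m + 1) :
    P.real {ω | ¬ HasCommonNeighbours ((fun e => w e ω) ∘ Sym2.map Subtype.val)
      (boxIndex (d := d) m k)} ≤ 4 ^ d * Real.exp (-m) := by
  have hunion := measureReal_not_hasCommonNeighbours_le
    (hw.comap (Subtype.val_injective (p := (· ∈ box d (2 ^ m))))) (boxIndex m k) hk₀ fun x => by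
      rw [card_cell_boxIndex hkm]
      exact Nat.pow_le_pow_right two_pos (Nat.mul_le_mul_right d hk₀k)
  have hdecay : (2 * d + 1 : ℝ) * m ≤ ((2 ^ (k₀ * d) : ℕ) : ℝ) / (4 * C ^ 4) := by
    rw [le_div_iff₀ (by positivity)]
    push_cast
    linarith
  have htwo : (2 : ℝ) ≤ Real.exp 1 := by linarith [Real.add_one_le_exp 1]
  refine hunion.trans ?_
  rw [Fintype.card_coe, card_box]
  calc ((2 ^ ((m + 1) * d) : ℕ) : ℝ) ^ 2 * Real.exp (-(((2 ^ (k₀ * d) : ℕ) : ℝ) / (4 * C ^ 4)))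
      ≤ ((2 ^ ((m + 1) * d) : ℕ) : ℝ) ^ 2 * Real.exp (-((2 * d + 1) * m)) := by gcongr
    _ = 4 ^ d * 2 ^ (2 * d * m) * Real.exp (-((2 * d + 1) * m)) := by
        rw [show (4 : ℝ) = 2 ^ 2 by norm_num]
        push_cast
        rw [← pow_mul, ← pow_mul, ← pow_add]
        ring_nf
    _ ≤ 4 ^ d * Real.exp 1 ^ (2 * d * m) * Real.exp (-((2 * d + 1) * m)) := by gcongr
    _ = 4 ^ d * Real.exp (-m) := by
        rw [mul_assoc, ← Real.exp_nat_mul, ← Real.exp_add]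
        push_cast
        ring_nf

theorem measureReal_exists_not_hasCommonNeighbours_le (hw : IsIndepConductance P w C)
    (hC : 0 < C) (hk₀ : 4 ≤ 2 ^ (k₀ * d)) (hm : 4 * C ^ 4 * (2 * d + 1) * m ≤ 2 ^ (k₀ * d)) :
    P.real {ω | ∃ k ∈ Icc k₀ (m + 1), ¬ HasCommonNeighbours
        ((fun e => w e ω) ∘ Sym2.map Subtype.val) (boxIndex (d := d) m k)} ≤
      4 ^ d * ((m + 2) * Real.exp (-m)) := by
  have hcover : {ω | ∃ k ∈ Icc k₀ (m + 1), ¬ HasCommonNeighbours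
      ((fun e => w e ω) ∘ Sym2.map Subtype.val) (boxIndex (d := d) m k)} =
      ⋃ k ∈ Icc k₀ (m + 1), {ω | ¬ HasCommonNeighbours
        ((fun e => w e ω) ∘ Sym2.map Subtype.val) (boxIndex (d := d) m k)} := by
    ext ω
    simp
  rw [hcover]
  refine (measureReal_biUnion_finset_le _ _).trans ((sum_le_sum fun k hk =>
    measureReal_not_hasCommonNeighbours_boxIndex_le hw hC hk₀ hm (mem_Icc.1 hk).1
      (mem_Icc.1 hk).2).trans ?_)
  rw [sum_const, nsmul_eq_mul, Nat.card_Icc, mul_left_comm]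
  gcongr
  exact_mod_cast Nat.sub_le (m + 1 + 1) k₀

end UnionBound

section LatticeSums

variable {d : ℕ} {α : ℝ}

theorem summable_len_rpow {r : ℝ} (hr : r < -d) : Summable fun z : Lat d => len z ^ r := by
  let b := (EuclideanSpace.basisFun (Fin d) ℝ).toBasis
  let bℤ := b.restrictScalars ℤ
  have hrank : Module.finrank ℤ (Submodule.span ℤ (Set.range b)) = d := by
    rw [Module.finrank_eq_card_basis bℤ, Fintype.card_fin]
  have hlen : ∀ z : Lat d, ‖bℤ.equivFun.symm z‖ = len z := fun z => by
    rw [len, Submodule.coe_norm, Module.Basis.equivFun_symm_apply]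
    congr 1
    ext i
    simp only [Submodule.coe_sum, Submodule.coe_smul, bℤ, Module.Basis.restrictScalars_apply]
    simp [b, toE_apply, Pi.single_apply]
  have hsum := ZLattice.summable_norm_rpow (Submodule.span ℤ (Set.range b)) r (by rwa [hrank])
  exact (bℤ.equivFun.symm.toEquiv.summable_iff.2 hsum).congr fun z => congrArg (· ^ r) (hlen z)

theorem sum_driftCoeff_sq {z : Lat d} (hz : z ≠ 0) :
    ∑ i, driftCoeff α i z ^ 2 = len z ^ (-((d : ℝ) + α)) * len z ^ (2 - d - α) := by
  have hlen : 0 < len z := one_pos.trans_le (one_le_len hz)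
  have hsq : ∑ i, (z i : ℝ) ^ 2 = len z ^ (2 : ℝ) := by
    rw [len, Real.rpow_two, EuclideanSpace.norm_sq_eq]
    simp [toE_apply]
  simp only [driftCoeff, div_pow, ← sum_div]
  rw [hsq, ← Real.rpow_mul_natCast hlen.le, ← Real.rpow_sub hlen, ← Real.rpow_add hlen]
  congr 1
  push_cast
  ring

theorem exists_sum_driftCoeff_sq_le (hα : 0 < α) : ∃ K : ℝ, 0 < K ∧ ∀ m : ℕ,
    ∑ i, ∑ z ∈ puncturedBall d (2 ^ m), driftCoeff α i z ^ 2 ≤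
      K * (2 : ℝ) ^ ((m : ℝ) * max (2 - d - α) 0) := by
  have hsum := summable_len_rpow (d := d) (r := -((d : ℝ) + α)) (by linarith)
  refine ⟨∑' z : Lat d, len z ^ (-((d : ℝ) + α)) + 1, add_pos_of_nonneg_of_pos
    (tsum_nonneg fun z => Real.rpow_nonneg (len_nonneg z) _) one_pos, fun m => ?_⟩
  rw [sum_comm, Real.rpow_mul zero_le_two, Real.rpow_natCast]
  calc ∑ z ∈ puncturedBall d (2 ^ m), ∑ i, driftCoeff α i z ^ 2
      ≤ ∑ z ∈ puncturedBall d (2 ^ m), len z ^ (-((d : ℝ) + α)) *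
          ((2 : ℝ) ^ m) ^ max (2 - d - α) 0 := by
        refine sum_le_sum fun z hz => ?_
        obtain ⟨hz0, hzm⟩ := (mem_puncturedBall z).1 hz
        rw [sum_driftCoeff_sq hz0]
        have hlen := one_le_len hz0
        gcongr
        calc len z ^ (2 - d - α) ≤ len z ^ max (2 - d - α) 0 :=
              Real.rpow_le_rpow_of_exponent_le hlen (le_max_left _ _)
          _ ≤ ((2 : ℝ) ^ m) ^ max (2 - d - α) 0 := by
              gcongr
              exact_mod_cast hzm
    _ ≤ _ := by
        rw [← sum_mul]
        gcongr
        exact (hsum.sum_le_tsum _ fun z _ => Real.rpow_nonneg (len_nonneg z) _).trans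
          (le_add_of_nonneg_right zero_le_one)

end LatticeSums

section SecondMoment

variable {Ω : Type*} [MeasurableSpace Ω] {P : Measure Ω} [IsProbabilityMeasure P]

theorem variance_sum_mul_le {ι κ : Type*} [DecidableEq κ] {X : κ → Ω → ℝ} {b c : ℝ}
    {S : Finset ι} {e : ι → κ} (hX : ∀ p ∈ S, AEMeasurable (X (e p)) P)
    (hbc : ∀ p ∈ S, ∀ᵐ ω ∂P, X (e p) ω ∈ Set.Icc b c)
    (hindep : ∀ p ∈ S, ∀ q ∈ S, e p ≠ e q → IndepFun (X (e p)) (X (e q)) P) {N : ℕ}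
    (hN : ∀ p ∈ S, #{q ∈ S | e q = e p} ≤ N) (a : ι → ℝ) :
    Var[fun ω => ∑ p ∈ S, a p * X (e p) ω; P] ≤ N * ((c - b) / 2) ^ 2 * ∑ p ∈ S, a p ^ 2 := by
  set A : κ → ℝ := fun k => ∑ p ∈ S with e p = k, a p with hA
  have hgroup : (fun ω => ∑ p ∈ S, a p * X (e p) ω) =
      ∑ k ∈ S.image e, fun ω => A k * X k ω := by
    ext ω
    rw [Finset.sum_apply, ← sum_fiberwise_of_maps_to (fun p => mem_image_of_mem e)]
    refine sum_congr rfl fun k _ => ?_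
    rw [hA, sum_mul]
    exact sum_congr rfl fun p hp => by rw [(mem_filter.1 hp).2]
  have hvar : ∀ p ∈ S, Var[fun ω => A (e p) * X (e p) ω; P] ≤
      ((c - b) / 2) ^ 2 * (N * ∑ q ∈ S with e q = e p, a q ^ 2) := fun p hp => by
    rw [variance_const_mul, mul_comm]
    refine mul_le_mul (variance_le_sq_of_bounded (hbc p hp) (hX p hp))
      (sq_sum_le_card_mul_sum_sq.trans ?_) (sq_nonneg _) (sq_nonneg _)
    gcongr
    exact hN p hp
  rw [hgroup, IndepFun.variance_sum]
  · calc ∑ k ∈ S.image e, Var[fun ω => A k * X k ω; P]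
        ≤ ∑ k ∈ S.image e, ((c - b) / 2) ^ 2 * (N * ∑ q ∈ S with e q = k, a q ^ 2) :=
          sum_le_sum fun k hk => by
            obtain ⟨p, hp, rfl⟩ := mem_image.1 hk
            exact hvar p hp
      _ = N * ((c - b) / 2) ^ 2 * ∑ p ∈ S, a p ^ 2 := by
          rw [← mul_sum, ← mul_sum, sum_fiberwise_of_maps_to fun p => mem_image_of_mem e]
          ring
  · intro k hk
    obtain ⟨p, hp, rfl⟩ := mem_image.1 hk
    exact (memLp_of_bounded (hbc p hp) (hX p hp).aestronglyMeasurable 2).const_mul _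
  · intro k hk l hl hkl
    obtain ⟨p, hp, rfl⟩ := mem_image.1 hk
    obtain ⟨q, hq, rfl⟩ := mem_image.1 hl
    exact (hindep p hp q hq hkl).comp (measurable_const_mul _) (measurable_const_mul _)

theorem card_filter_sym2_add_le_two {G : Type*} [AddGroup G] [DecidableEq G] (S : Finset (G × G))
    (p : G × G) : #{q ∈ S | s(q.1, q.1 + q.2) = s(p.1, p.1 + p.2)} ≤ 2 := by
  refine (card_le_card (t := {p, (p.1 + p.2, -p.2)}) fun q hq => ?_).trans card_le_two
  rw [mem_insert, mem_singleton]
  rcases Sym2.eq_iff.1 (mem_filter.1 hq).2 with ⟨h1, h2⟩ | ⟨h1, h2⟩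
  · exact .inl (Prod.ext h1 (add_left_cancel (h1 ▸ h2)))
  · refine .inr (Prod.ext h1 ?_)
    rw [h1, add_assoc, add_eq_left] at h2
    exact (neg_eq_of_add_eq_zero_right h2).symm

namespace IsIndepConductance

variable {d : ℕ} {α : ℝ} {w : Sym2 (Lat d) → Ω → ℝ} {C : ℝ}

theorem memLp_drift (hw : IsIndepConductance P w C) (m : ℕ) (x : Lat d) (i : Fin d) :
    MemLp (fun ω => drift α (fun e => w e ω) m x i) 2 P := by
  simp only [drift_apply]
  refine memLp_finsetSum _ fun z hz => ?_
  have he : ¬ (s(x, x + z)).IsDiag := by simpa using ((mem_puncturedBall z).1 hz).1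
  exact (memLp_of_bounded (hw.mem_Icc _ he) (hw.measurable _ he).aestronglyMeasurable 2).const_mul _

theorem integral_sum_drift_sq_le (hw : IsIndepConductance P w C) (Q : Finset (Lat d)) (m : ℕ)
    (i : Fin d) :
    ∫ ω, (∑ x ∈ Q, drift α (fun e => w e ω) m x i) ^ 2 ∂P ≤
      C ^ 2 / 2 * (#Q * ∑ z ∈ puncturedBall d (2 ^ m), driftCoeff α i z ^ 2) := by
  set S := Q ×ˢ puncturedBall d (2 ^ m) with hS
  have he : ∀ p ∈ S, ¬ (s(p.1, p.1 + p.2)).IsDiag := fun p hp => by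
    simpa using ((mem_puncturedBall p.2).1 (mem_product.1 hp).2).1
  have hdrift : ∀ ω, ∑ x ∈ Q, drift α (fun e => w e ω) m x i =
      ∑ p ∈ S, driftCoeff α i p.2 * w s(p.1, p.1 + p.2) ω := fun ω => by
    simp only [drift_apply, hS, sum_product]
  have hint : ∀ p ∈ S, Integrable (fun ω => driftCoeff α i p.2 * w s(p.1, p.1 + p.2) ω) P :=
    fun p hp => (hw.integrable (he p hp)).const_mul _
  have hmean : ∫ ω, ∑ p ∈ S, driftCoeff α i p.2 * w s(p.1, p.1 + p.2) ω ∂P = 0 := by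
    rw [integral_finsetSum _ hint]
    calc ∑ p ∈ S, ∫ ω, driftCoeff α i p.2 * w s(p.1, p.1 + p.2) ω ∂P
        = ∑ p ∈ S, driftCoeff α i p.2 := sum_congr rfl fun p hp => by
          rw [integral_const_mul, hw.integral_eq_one _ (he p hp), mul_one]
      _ = 0 := by rw [hS, sum_product, sum_congr rfl fun x _ => sum_driftCoeff m i, sum_const_zero]
  simp only [hdrift]
  rw [← variance_of_integral_eq_zero (integrable_finsetSum _ hint).aemeasurable hmean]
  refine (variance_sum_mul_le (e := fun p : Lat d × Lat d => s(p.1, p.1 + p.2))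
    (fun p hp => (hw.measurable _ (he p hp)).aemeasurable) (fun p hp => hw.mem_Icc _ (he p hp))
    (fun p hp q hq hpq => ?_) (fun p _ => card_filter_sym2_add_le_two S p)
    (fun p => driftCoeff α i p.2)).trans_eq ?_
  · exact hw.indep.indepFun (i := ⟨_, he p hp⟩) (j := ⟨_, he q hq⟩) fun h =>
      hpq (congrArg Subtype.val h)
  · simp only [hS, sum_product, sum_const, nsmul_eq_mul]
    ring

theorem integral_cellAvg_drift_sq_le (hw : IsIndepConductance P w C) {m k : ℕ} (hk : k ≤ m + 1)
    (x : box d (2 ^ m)) (i : Fin d) :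
    ∫ ω, cellAvg (boxIndex m k) (fun y => drift α (fun e => w e ω) m y i) x ^ 2 ∂P ≤
      C ^ 2 / 2 * (((2 : ℝ) ^ d) ^ k)⁻¹ *
        ∑ z ∈ puncturedBall d (2 ^ m), driftCoeff α i z ^ 2 := by
  have hcard : ((cell (boxIndex m k) x).card : ℝ) = ((2 : ℝ) ^ d) ^ k := by
    rw [card_cell_boxIndex hk, Nat.cast_pow, Nat.cast_ofNat, ← pow_mul, mul_comm]
  have hsum := hw.integral_sum_drift_sq_le (α := α)
    ((cell (boxIndex m k) x).map (Function.Embedding.subtype _)) m i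
  simp only [sum_map, card_map, Function.Embedding.subtype_apply, hcard] at hsum
  simp only [cellAvg, expect_eq_sum_div_card, hcard, div_pow]
  rw [integral_div, div_le_iff₀ (by positivity)]
  refine hsum.trans_eq ?_
  field_simp

theorem integrable_cellAvg_drift_sq (hw : IsIndepConductance P w C) (m k : ℕ)
    (x : box d (2 ^ m)) (i : Fin d) : Integrable (fun ω =>
      cellAvg (boxIndex m k) (fun y => drift α (fun e => w e ω) m y i) x ^ 2) P := by
  have hsum : MemLp (fun ω => ∑ y ∈ cell (boxIndex m k) x, drift α (fun e => w e ω) m y i) 2 P :=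
    memLp_finsetSum _ fun y _ => hw.memLp_drift m y i
  simp only [cellAvg, expect_eq_sum_div_card, div_pow]
  exact hsum.integrable_sq.div_const _

theorem integrable_driftFluctuation (hw : IsIndepConductance P w C) (m : ℕ) :
    Integrable (fun ω => driftFluctuation α (fun e => w e ω) m) P := by
  simp only [driftFluctuation]
  exact integrable_finsetSum _ fun i _ => integrable_finsetSum _ fun k _ =>
    (integrable_finsetSum _ fun x _ => hw.integrable_cellAvg_drift_sq m k x i).const_mul _

theorem integral_driftFluctuation_le (hw : IsIndepConductance P w C) (hd : α < d) (m : ℕ) :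
    ∫ ω, driftFluctuation α (fun e => w e ω) m ∂P ≤
      C ^ 2 / 2 * (1 - (2 : ℝ) ^ (((d : ℝ) + α) / 2) / 2 ^ d)⁻¹ * (2 : ℝ) ^ ((m + 1) * d) *
        ∑ i, ∑ z ∈ puncturedBall d (2 ^ m), driftCoeff α i z ^ 2 := by
  have hρ : (2 : ℝ) ^ (((d : ℝ) + α) / 2) < 2 ^ d := by
    rw [← Real.rpow_natCast]
    exact Real.rpow_lt_rpow_of_exponent_lt one_lt_two (by linarith)
  have hint := fun i k x => hw.integrable_cellAvg_drift_sq (α := α) m k x i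
  simp only [driftFluctuation]
  rw [integral_finsetSum _ fun i _ => integrable_finsetSum _ fun k _ =>
    (integrable_finsetSum _ fun x _ => hint i k x).const_mul _, mul_sum]
  refine sum_le_sum fun i _ => ?_
  rw [integral_finsetSum _ fun k _ => (integrable_finsetSum _ fun x _ => hint i k x).const_mul _]
  set ρ := (2 : ℝ) ^ (((d : ℝ) + α) / 2)
  set M := ∑ z ∈ puncturedBall d (2 ^ m), driftCoeff α i z ^ 2
  have : 0 ≤ M := sum_nonneg fun z _ => sq_nonneg _
  have : 0 < ρ := by positivity
  calc ∑ k ∈ range (m + 1), ∫ ω, ρ ^ k * ∑ x : box d (2 ^ m),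
          cellAvg (boxIndex m k) (fun y => drift α (fun e => w e ω) m y i) x ^ 2 ∂P
      ≤ ∑ k ∈ range (m + 1), ρ ^ k *
          ∑ _x : box d (2 ^ m), C ^ 2 / 2 * (((2 : ℝ) ^ d) ^ k)⁻¹ * M := by
        refine sum_le_sum fun k hk => ?_
        rw [integral_const_mul, integral_finsetSum _ fun x _ => hint i k x]
        gcongr with x
        exact hw.integral_cellAvg_drift_sq_le (mem_range.1 hk).le x i
    _ = C ^ 2 / 2 * (∑ k ∈ range (m + 1), (ρ / 2 ^ d) ^ k) * (2 : ℝ) ^ ((m + 1) * d) * M := by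
        simp only [sum_const, card_univ, Fintype.card_coe, card_box, nsmul_eq_mul, mul_sum,
          sum_mul, div_pow]
        refine sum_congr rfl fun k _ => ?_
        push_cast
        ring
    _ ≤ _ := by
        gcongr
        rw [← tsum_geometric_of_lt_one (by positivity) ((div_lt_one (by positivity)).2 hρ)]
        exact (summable_geometric_of_lt_one (by positivity)
          ((div_lt_one (by positivity)).2 hρ)).sum_le_tsum _ fun k _ => by positivity

end IsIndepConductance

end SecondMoment

section AlmostSure

open Filter

variable {Ω : Type*} [MeasurableSpace Ω] {P : Measure Ω} [IsProbabilityMeasure P]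

theorem exists_measurable_last_time (N : ℕ) {s : ℕ → Set Ω} {b : ℕ → ℝ} (hb : Summable b)
    (hs : ∀ m, N < m → P.real (s m) ≤ b m) :
    ∃ T : Ω → ℕ, Measurable T ∧ (∀ ω, N ≤ T ω) ∧ ∀ᵐ ω ∂P, ∀ m, T ω < m → ω ∉ s m := by
  classical
  set t : ℕ → Set Ω := fun m => toMeasurable P (s m)
  have hlimsup : P (limsup t atTop) = 0 := by
    have hsum : Summable fun m => P.real (s m) := by
      refine .of_norm_bounded_eventually_nat hb ?_
      filter_upwards [eventually_gt_atTop N] with m hm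
      rw [Real.norm_of_nonneg measureReal_nonneg]
      exact hs m hm
    exact measure_limsup_atTop_eq_zero
      (by simpa [t, measure_toMeasurable] using hsum.tsum_ofReal_ne_top)
  have hfind : ∀ ω, ∃ n, ω ∈ (⋂ m, ⋂ (_ : n < m), (t m)ᶜ) ∪ limsup t atTop := by
    intro ω
    by_cases hω : ω ∈ limsup t atTop
    · exact ⟨0, .inr hω⟩
    · rw [mem_limsup_iff_frequently_mem, not_frequently, eventually_atTop] at hω
      obtain ⟨n, hn⟩ := hω
      exact ⟨n, .inl (Set.mem_iInter₂.2 fun m hm => hn m hm.le)⟩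
  have htm : ∀ m, MeasurableSet (t m) := fun m => measurableSet_toMeasurable P (s m)
  refine ⟨fun ω => N + Nat.find (hfind ω), (measurable_find hfind fun n =>
    (MeasurableSet.iInter fun m => .iInter fun _ => (htm m).compl).union
      (.measurableSet_limsup htm)).const_add N, fun ω => Nat.le_add_right _ _, ?_⟩
  filter_upwards [measure_eq_zero_iff_ae_notMem.1 hlimsup] with ω hω m hm hmem
  rcases Nat.find_spec (hfind ω) with h | h
  · exact Set.mem_iInter₂.1 h m (by lia) (subset_toMeasurable P _ hmem)
  · exact hω h

namespace IsIndepConductance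

variable {d : ℕ} {α : ℝ} {w : Sym2 (Lat d) → Ω → ℝ} {C : ℝ}

theorem pos (hw : IsIndepConductance P w C) (hd : 0 < d) : 0 < C := by
  have : Nonempty (Fin d) := ⟨⟨0, hd⟩⟩
  exact one_pos.trans_le (hw.one_le (e := s(0, 1)) (by simp))

theorem exists_measureReal_lt_driftFluctuation_le (hw : IsIndepConductance P w C) (hα : 0 < α)
    (hd : α < d) : ∃ K : ℝ, 0 < K ∧ ∀ (m : ℕ) (s : ℝ), 0 < s →
      P.real {ω | s * (K * (2 : ℝ) ^ ((m : ℝ) * (d + max (2 - d - α) 0))) <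
        driftFluctuation α (fun e => w e ω) m} ≤ s⁻¹ := by
  have hC : 0 < C := hw.pos (by exact_mod_cast hα.trans hd)
  obtain ⟨K, hK0, hK⟩ := exists_sum_driftCoeff_sq_le (d := d) hα
  have hgap : 0 < 1 - (2 : ℝ) ^ (((d : ℝ) + α) / 2) / 2 ^ d := by
    rw [sub_pos, div_lt_one (by positivity), ← Real.rpow_natCast]
    exact Real.rpow_lt_rpow_of_exponent_lt one_lt_two (by linarith)
  refine ⟨C ^ 2 / 2 * (1 - (2 : ℝ) ^ (((d : ℝ) + α) / 2) / 2 ^ d)⁻¹ * 2 ^ d * K, by positivity,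
    fun m s hs => ?_⟩
  set M := C ^ 2 / 2 * (1 - (2 : ℝ) ^ (((d : ℝ) + α) / 2) / 2 ^ d)⁻¹ * 2 ^ d * K *
    (2 : ℝ) ^ ((m : ℝ) * (d + max (2 - d - α) 0)) with hM
  have hM0 : 0 < M := by positivity
  have hmean : ∫ ω, driftFluctuation α (fun e => w e ω) m ∂P ≤ M := by
    refine ((hw.integral_driftFluctuation_le hd m).trans
      (mul_le_mul_of_nonneg_left (hK m) (by positivity))).trans_eq ?_
    rw [hM, mul_add, Real.rpow_add two_pos, ← Nat.cast_mul, Real.rpow_natCast]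
    ring
  have hmarkov := mul_meas_ge_le_integral_of_nonneg (.of_forall fun ω => driftFluctuation_nonneg)
    (hw.integrable_driftFluctuation (α := α) m) (s * M)
  rw [← one_div, le_div_iff₀ hs, ← mul_le_mul_iff_of_pos_right hM0, mul_assoc, mul_comm, one_mul]
  refine le_trans ?_ (hmarkov.trans hmean)
  gcongr with ω
  exacts [measure_ne_top _ _, le_of_lt]

theorem exists_measurable_hasCommonNeighbours_and_driftFluctuation_le
    (hw : IsIndepConductance P w C) (hα : 0 < α) (hd : α < d) {δ : ℝ} (hδ : 0 < δ) :
    ∃ A : ℝ, 0 < A ∧ ∃ T : Ω → ℕ, Measurable T ∧ (∀ ω, 1 ≤ T ω) ∧ ∀ᵐ ω ∂P, ∀ m : ℕ, T ω < m →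
      ∃ k ≤ m + 1, (∀ j, k ≤ j → j ≤ m + 1 →
          HasCommonNeighbours ((fun e => w e ω) ∘ Sym2.map Subtype.val) (boxIndex (d := d) m j)) ∧
        ((2 : ℝ) ^ α) ^ k * driftFluctuation α (fun e => w e ω) m ≤
          A * ((m : ℝ) ^ (1 + δ + α / d) * (2 : ℝ) ^ ((m : ℝ) * (d + max (2 - d - α) 0))) := by
  have hd0 : 0 < d := by exact_mod_cast hα.trans hd
  obtain ⟨K, hK0, hK⟩ := hw.exists_measureReal_lt_driftFluctuation_le hα hd
  obtain ⟨B, hB0, hB⟩ := exists_scale hd0 hα.le (4 * C ^ 4 * (2 * d + 1))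
  obtain ⟨N, hN⟩ := eventually_atTop.1 hB
  choose! k hkm hk4 hka hkB using hN
  have hsummable : Summable fun m : ℕ => 4 ^ d * ((m + 2) * Real.exp (-m)) +
      ((m : ℝ) ^ (1 + δ))⁻¹ := by
    have hexp (j : ℕ) := Real.summable_pow_mul_exp_neg_nat_mul j one_pos
    refine ((((hexp 1).add ((hexp 0).mul_left 2)).mul_left (4 ^ d)).congr fun m => ?_).add
      (Real.summable_nat_rpow_inv.2 (by linarith))
    simp only [pow_one, pow_zero, one_mul, neg_mul]
    ring
  obtain ⟨T, hT, hNT, hgood⟩ := exists_measurable_last_time (P := P) (max N 1) hsummable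
    fun m hm => (measureReal_union_le _ _).trans (add_le_add
      (measureReal_exists_not_hasCommonNeighbours_le hw (hw.pos hd0) (hk4 m (by lia))
        (hka m (by lia)))
      (hK m _ (Real.rpow_pos_of_pos (by exact_mod_cast (by lia)) (1 + δ))))
  refine ⟨B * K, by positivity, T, hT, fun ω => (le_max_right N 1).trans (hNT ω), ?_⟩
  filter_upwards [hgood] with ω hω m hm
  have hNm : N ≤ m := (le_max_left N 1).trans ((hNT ω).trans hm.le)
  have hbad := hω m hm
  simp only [Set.mem_union, Set.mem_ofPred_eq, not_or, not_exists, not_and, not_not, not_lt,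
    Finset.mem_Icc, and_imp] at hbad
  obtain ⟨hn, hfluct⟩ := hbad
  refine ⟨k m, hkm m hNm, hn, (mul_le_mul (hkB m hNm) hfluct driftFluctuation_nonneg
    (by positivity)).trans_eq ?_⟩
  rw [Real.rpow_add' (y := 1 + δ) (z := α / d) m.cast_nonneg (by positivity)]
  ring

end IsIndepConductance

end AlmostSure

section Rates

open Filter

theorem rpow_mul_two_rpow_le_energyRate_one {d : ℕ} {γ : ℝ} (hd : (1 : ℝ) < d) (hγ : 0 ≤ γ)
    {m : ℕ} (hm : 1 ≤ m) :
    (m : ℝ) ^ (2 + 1 / (d : ℝ)) * (2 : ℝ) ^ ((m : ℝ) * (d + max (2 - (d : ℝ) - 1) 0)) ≤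
      energyRate d 1 γ m := by
  rw [energyRate, if_pos rfl, max_eq_right (by linarith), add_zero]
  have : 0 < min (2 * ((d : ℝ) - 1)) d := lt_min (by linarith) (by linarith)
  gcongr
  · exact_mod_cast hm
  · linarith
  · exact min_le_right _ _

theorem exists_rpow_mul_two_rpow_le_energyRate_of_lt_one {d : ℕ} {α γ : ℝ} (hα : 0 < α)
    (hα1 : α < 1) (hd : α < d) (hγ : 0 ≤ γ) : ∃ A : ℝ, 0 < A ∧ ∀ m : ℕ, 1 ≤ m →
      (m : ℝ) ^ (2 + α / d) * (2 : ℝ) ^ ((m : ℝ) * (d + max (2 - d - α) 0)) ≤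
        A * energyRate d α γ m := by
  have hd1 : (1 : ℝ) ≤ d := by exact_mod_cast (by exact_mod_cast hα.trans hd : 0 < d)
  obtain ⟨A, hA0, hA⟩ := Asymptotics.bound_of_isBigO_nat_atTop
    (isLittleO_pow_const_const_pow_of_one_lt (R := ℝ) 3
      (Real.one_lt_rpow one_lt_two (sub_pos.2 hα1))).isBigO
  refine ⟨A, hA0, fun m hm => ?_⟩
  have hm1 : (1 : ℝ) ≤ m := by exact_mod_cast hm
  have hpow : (m : ℝ) ^ 3 ≤ A * (2 : ℝ) ^ ((m : ℝ) * (1 - α)) := by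
    have h := hA (x := m) (by positivity)
    rwa [Real.norm_of_nonneg (by positivity), Real.norm_of_nonneg (by positivity),
      ← Real.rpow_mul_natCast zero_le_two, mul_comm (1 - α)] at h
  have hexp : 2 + α / d ≤ (3 : ℕ) := by
    have : α / d ≤ 1 := (div_le_one (by linarith)).2 hd.le
    push_cast
    linarith
  have hlog : 1 ≤ (m : ℝ) ^ ((1 + γ) * α / min (2 * ((d : ℝ) - α)) d) := by
    have : 0 < min (2 * ((d : ℝ) - α)) d := lt_min (by linarith) (by linarith)
    exact Real.one_le_rpow hm1 (by positivity)
  calc (m : ℝ) ^ (2 + α / d) * (2 : ℝ) ^ ((m : ℝ) * (d + max (2 - d - α) 0))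
      ≤ (m : ℝ) ^ (3 : ℕ) * (2 : ℝ) ^ ((m : ℝ) * (d + (1 - α))) := by
        rw [← Real.rpow_natCast (m : ℝ) 3]
        gcongr
        · exact one_le_two
        · exact max_le (by linarith) (by linarith)
    _ ≤ A * (2 : ℝ) ^ ((m : ℝ) * (1 - α)) * (2 : ℝ) ^ ((m : ℝ) * (d + (1 - α))) := by gcongr
    _ = A * (1 * (2 : ℝ) ^ ((m : ℝ) * (d + 2 * (1 - α)))) := by
        rw [mul_assoc, ← Real.rpow_add two_pos]
        ring_nf
    _ ≤ A * energyRate d α γ m := by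
        rw [energyRate, if_neg hα1.ne]
        gcongr

theorem exists_rpow_mul_two_rpow_le_energyRate {d : ℕ} {α γ : ℝ} (hα : 0 < α) (hα1 : α ≤ 1)
    (hd : α < d) (hγ : 0 ≤ γ) : ∃ A : ℝ, 0 < A ∧ ∀ m : ℕ, 1 ≤ m →
      (m : ℝ) ^ (2 + α / d) * (2 : ℝ) ^ ((m : ℝ) * (d + max (2 - d - α) 0)) ≤
        A * energyRate d α γ m := by
  rcases hα1.lt_or_eq with hlt | rfl
  · exact exists_rpow_mul_two_rpow_le_energyRate_of_lt_one hα hlt hd hγ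
  · refine ⟨1, one_pos, fun m hm => ?_⟩
    rw [one_mul]
    exact rpow_mul_two_rpow_le_energyRate_one hd hγ hm

end Rates

/-- The local Poisson equation is almost surely uniquely solvable at all large scales `m`, and the
energy of its solution is at most of order `r m`. The random scale from which on this holds is
natural-valued and bounded below by one. -/
def HasCorrectorEnergyBound {d : ℕ} {Ω : Type*} [MeasurableSpace Ω] (P : Measure Ω)
    (w : Sym2 (Lat d) → Ω → ℝ) (α : ℝ) (r : ℕ → ℝ) : Prop :=
  ∃ C : ℝ, 0 < C ∧ ∃ T : Ω → ℕ, Measurable T ∧ (∀ ω, 1 ≤ T ω) ∧ ∀ᵐ ω ∂P, ∀ m : ℕ, T ω < m →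
    (∃! φ : box d (2 ^ m) → EuclideanSpace ℝ (Fin d), IsCorrector α (fun e => w e ω) m φ) ∧
      ∀ φ : box d (2 ^ m) → EuclideanSpace ℝ (Fin d), IsCorrector α (fun e => w e ω) m φ →
        energyOn α (fun e => w e ω) (box d (2 ^ m)) φ ≤ C * r m

theorem HasCorrectorEnergyBound.mono {d : ℕ} {Ω : Type*} [MeasurableSpace Ω] {P : Measure Ω}
    {w : Sym2 (Lat d) → Ω → ℝ} {α : ℝ} {r r' : ℕ → ℝ} (h : HasCorrectorEnergyBound P w α r)
    (hr : ∃ A : ℝ, 0 < A ∧ ∀ m : ℕ, 1 ≤ m → r m ≤ A * r' m) :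
    HasCorrectorEnergyBound P w α r' := by
  obtain ⟨C, hC, T, hT, hT1, h⟩ := h
  obtain ⟨A, hA, hr⟩ := hr
  refine ⟨C * A, mul_pos hC hA, T, hT, hT1, h.mono fun ω hω m hm => ?_⟩
  refine ⟨(hω m hm).1, fun φ hφ => ((hω m hm).2 φ hφ).trans ?_⟩
  rw [mul_assoc]
  exact mul_le_mul_of_nonneg_left (hr m ((hT1 ω).trans hm.le)) hC.le

theorem IsConductance.exists_isIndepConductance {d : ℕ} {Ω : Type*} [MeasurableSpace Ω]
    {P : Measure Ω} {w : Sym2 (Lat d) → Ω → ℝ} (hw : IsConductance P w) :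
    ∃ C, IsIndepConductance P w C := by
  obtain ⟨C, -, hC⟩ := hw.bounded
  exact ⟨C, fun e he => hw.measurable ⟨e, he⟩, hw.indep,
    fun e he => (hw.nonneg ⟨e, he⟩).and (hC ⟨e, he⟩), fun e he => hw.mean_one ⟨e, he⟩⟩

end StableConductance

open StableConductance in
theorem proposition3p2_general {d : ℕ} {α : ℝ} (hα : 0 < α) (hd : α < d) {Ω : Type*}
    [MeasurableSpace Ω] (P : Measure Ω) [IsProbabilityMeasure P] (w : Sym2 (Lat d) → Ω → ℝ)
    {C : ℝ} (hw : IsIndepConductance P w C) {δ : ℝ} (hδ : 1 < δ) :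
    HasCorrectorEnergyBound P w α fun m =>
      (m : ℝ) ^ (δ + α / d) * (2 : ℝ) ^ ((m : ℝ) * (d + max (2 - d - α) 0)) := by
  have hC : 0 < C := hw.pos (by exact_mod_cast hα.trans hd)
  obtain ⟨D, hD0, hD⟩ := exists_energyOn_le_driftFluctuation hα hd hC
  obtain ⟨A, hA0, T, hT, hT1, hgood⟩ :=
    hw.exists_measurable_hasCommonNeighbours_and_driftFluctuation_le hα hd (sub_pos.2 hδ)
  refine ⟨D * A, by positivity, T, hT, hT1, ?_⟩
  filter_upwards [hgood, hw.ae_mem_Icc] with ω hω hc m hm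
  obtain ⟨k, hkm, hn, hfluct⟩ := hω m hm
  refine ⟨existsUnique_isCorrector hα hC.le hc (hn _ hkm le_rfl), fun φ hφ => ?_⟩
  rw [add_sub_cancel] at hfluct
  rw [mul_assoc]
  exact (hD _ m k hc hkm hn φ hφ).trans (mul_le_mul_of_nonneg_left hfluct hD0.le)

open StableConductance in
theorem proposition3p2 {d : ℕ} {α : ℝ} (hα : 0 < α) (hα1 : α ≤ 1) (hd : α < d)
    {Ω : Type*} [MeasurableSpace Ω] (P : Measure Ω) [IsProbabilityMeasure P]
    (w : Sym2 (Lat d) → Ω → ℝ) (hw : IsConductance P w) (γ : ℝ) (hγ : 0 < γ) :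
    ∃ C : ℝ, 0 < C ∧ ∃ mstar : Ω → ℕ, Measurable mstar ∧ (∀ ω, 1 ≤ mstar ω) ∧
      ∀ᵐ ω ∂P, ∀ m : ℕ, mstar ω < m →
        (∃! φ : box d (2 ^ m) → EuclideanSpace ℝ (Fin d), IsCorrector α (fun e => w e ω) m φ) ∧
        ∀ φ : box d (2 ^ m) → EuclideanSpace ℝ (Fin d), IsCorrector α (fun e => w e ω) m φ →
          energyOn α (fun e => w e ω) (box d (2 ^ m)) φ ≤ C * energyRate d α γ m := by
  obtain ⟨C₁, hw'⟩ := hw.exists_isIndepConductance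
  exact (proposition3p2_general hα hd P w hw' one_lt_two).mono
    (exists_rpow_mul_two_rpow_le_energyRate hα hα1 hd hγ.le)

end
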